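/- **Theorem 2.** *Problem.* Let $\mathcal N=\{1,\dots,N\}$ be a set of agents. Agent $i$ has decision $x_i\in\mathbb R^{n_i}$, local feasible set $\mathcal X_i\subseteq\mathbb R^{n_i}$, matrix $A_i\in\mathbb R^{l\times n_i}$ and objective $J_i:\mathbb R^{n_i}\times\mathbb R^l\to\mathbb R\cup\{+\infty\}$ (an objective defined only on $\mathcal X_i\times\mathbb R^l$ is extended by $+\infty$); let $c\in\mathbb R^l$ and $s_i(x)=\sum_{j\ne i}A_jx_j$. The problem is $$\min\ J(x)=\sum_{i}J_i(x_i,s_i(x))\quad\text{s.t. } x_i\in\mathcal X_i\ (i\in\mathcal N),\quad \sum_iA_ix_i\le c. \tag{P}$$ *Assumptions.* 1. Each $J_i$ is closed, convex and proper. 2. Each $\mathcal X_i$ is nonempty, closed and convex, and Slater's condition holds: there is $\bar x$ with $\bar x_i\in\mathcal X_i$ and $\sum_iA_i\bar x_i<c$ in every coordinate such that, for every $i$, $(\bar x_i,s_i(\bar x))\in\operatorname{ri}\operatorname{dom}J_i$ and, unless $\operatorname{dom}J_i\subseteq\mathcal X_i\times\mathbb R^l$, also $\bar x_i\in\operatorname{ri}\mathcal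 X_i$. (If $\operatorname{dom}J_i=\mathcal X_i\times\mathbb R^l$ for all $i$, or all $J_i$ are finite everywhere, this just says that some $x\in\prod_i\mathcal X_i$ has $\sum_iA_ix_i<c$.) 3. (P) has a minimizer (a feasible point with $J<+\infty$ and minimal value). 4. $\mathcal G=(\mathcal N,\mathcal E)$ is a graph with directed edges (tail, head) that is undirected ($(i,j)\in\mathcal E\Leftrightarrow(j,i)\in\mathcal E$), connected and without self-loops, and every agent has an out-neighbour. $\mathcal N_i^+$ and $\mathcal N_i^-$ denote the in- and out-neighbours of $i$. $W\in\mathbb R^{N\times N}$ has $W_{ij}<0$ for $(i,j)\in\mathcal E$, $W_{ij}=0$ for all other $i\neq j$, and $W_{ii}=-\sum_{j\ne i}W_{ij}$. *The operator $T$.* Let $\psi=[x;\sigma;\lambda;\omega]$ with $\sigma_i\in\mathbb R^l$ per agent, $\lambda_{ji}\in\mathbb R^l$ per edge $(j,i)$, and $\omega=[\omega_i]_i$ where $\omega_i$ collects $y_i\in\mathbb R^l$ and $\mu_{ij},y_{ij}\in\mathbb R^l$ for $j\in\mathcal N_i^-$; put $\boldsymbol y_i=[y_i;[y_{ji}]_{j\in\mathcal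 N_i^+}]$. Let $\mathcal Q_i=\{(x_i,\sigma_i):A_ix_i+\sigma_i\le c\}$ and $\mathcal F_i=\{(x_i,\sigma_i,\boldsymbol y_i):(N-1)A_ix_i-\sigma_i=W_{ii}y_i+\sum_{j\in\mathcal N_i^+}W_{ji}y_{ji}\}$. Let $A=\operatorname{blkd}(A_i)$ and $B_l=B\otimes I_l$ with $B$ the incidence matrix ($+1$ at the head, $-1$ at the tail of an edge), and let $M_y'$ be the skew-symmetric linear map sending $\omega$ to the vector with $y_i$-component $-\sum_{j\in\mathcal N_i^-}\mu_{ij}$, $\mu_{ij}$-component $y_i-y_{ij}$ and $y_{ij}$-component $\mu_{ij}$. With $\iota$ the indicator function ($0$ on the set, $+\infty$ off it), define $$T\psi=\partial\Big(\sum_iJ_i(x_i,\sigma_i)+\iota_{\mathcal X_i}(x_i)+\iota_{\mathcal Q_i}(x_i,\sigma_i)+\iota_{\mathcal F_i}(x_i,\sigma_i,\boldsymbol y_i)\Big)+\begin{bmatrix}0&0&A^TB_l&0\\0&0&B_l&0\\-B_l^TA&-B_l^T&0&0\\0&0&0&M_y'\end{bmatrix}\psi .$$ Let $\tau_{1i},\tau_{2i},\tau_{4i}>0$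 ($i\in\mathcal N$) and $\tau_{3e}>0$ ($e\in\mathcal E$) be step sizes, let $\boldsymbol\tau_1,\dots,\boldsymbol\tau_4$ be the corresponding diagonal matrices (in $\boldsymbol\tau_4$ every component of $\omega_i$ has the entry $\tau_{4i}$), and $$\Phi=\begin{bmatrix}\boldsymbol\tau_1^{-1}&0&-\frac12A^TB_l&0\\0&\boldsymbol\tau_2^{-1}&-\frac12B_l&0\\-\frac12B_l^TA&-\frac12B_l^T&\boldsymbol\tau_3^{-1}&0\\0&0&0&\boldsymbol\tau_4^{-1}\end{bmatrix}.$$ *The algorithm.* Put $\lambda_{iB}=\sum_{j\in\mathcal N_i^+}\lambda_{ji}-\sum_{j\in\mathcal N_i^-}\lambda_{ij}$ and, for an edge $(j,i)$, $\delta_{ji}(\psi)=A_ix_i+\sigma_i-A_jx_j-\sigma_j$. From an arbitrary $\tilde\psi^{(0)}$, iteration $k=0,1,\dots$ computes $\psi=\psi^{(k+1)}$, $\hat\psi=\hat\psi^{(k+1)}$, $\bar\psi=\bar\psi^{(k+1)}$ and $\tilde\psi^{(k+1)}$ from $\tilde\psi=\tilde\psi^{(k)}$ as follows. - $y_i=\frac{1+\tau_{4i}^2}{1+\tau_{4i}^2(1+|\mathcal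 N_i^-|)}\Big(\tilde y_i+\frac{\tau_{4i}}{1+\tau_{4i}^2}\sum_{j\in\mathcal N_i^-}(\tilde\mu_{ij}+\tau_{4i}\tilde y_{ij})\Big)$ for $i\in\mathcal N$; then $\mu_{ji}=\frac{1}{1+\tau_{4j}^2}\tilde\mu_{ji}+\frac{\tau_{4j}}{1+\tau_{4j}^2}(\tilde y_{ji}-y_j)$ and $y_{ji}=\tilde y_{ji}-\tau_{4j}\mu_{ji}$ for $(j,i)\in\mathcal E$. - $(x_i,\sigma_i)$ minimizes $J_i(x_i,\sigma_i)+\frac12\tilde\lambda_{iB}^T(A_ix_i+\sigma_i)+\frac1{2\tau_{1i}}\|x_i-\tilde x_i\|^2+\frac1{2\tau_{2i}}\|\sigma_i-\tilde\sigma_i\|^2$. - $\lambda_{ji}=\tilde\lambda_{ji}+\frac12\tau_{3ji}\,\delta_{ji}(\hat\psi)$, where $\hat\psi=2\psi-\tilde\psi$ (only its $x$- and $\sigma$-components are needed here). - $(\bar x_i,\bar\sigma_i,\bar{\boldsymbol y}_i)$ minimizes $\frac1{2\tau_{1i}}\|x_i-\hat x_i+\frac{\tau_{1i}}2A_i^T\hat\lambda_{iB}\|^2+\frac1{2\tau_{2i}}\|\sigma_i-\hat\sigma_i+\frac{\tau_{2i}}2\hat\lambda_{iB}\|^2+\frac1{2\tau_{4i}}\|y_i-\hat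 y_i\|^2+\sum_{j\in\mathcal N_i^+}\frac1{2\tau_{4j}}\|y_{ji}-\hat y_{ji}\|^2$ subject to $x_i\in\mathcal X_i$, $(x_i,\sigma_i,\boldsymbol y_i)\in\mathcal F_i$, $A_ix_i+\sigma_i\le c$. - $\bar\lambda_{ji}=\hat\lambda_{ji}+\tau_{3ji}\big(\delta_{ji}(\bar\psi)-\frac12\delta_{ji}(\hat\psi)\big)$ and $\bar\mu_{ji}=\hat\mu_{ji}$. - $\tilde\psi^{(k+1)}=\tilde\psi^{(k)}+2\gamma^{(k)}(\bar\psi-\psi)$. *Claim.* Suppose assumptions 1–4 hold, $\Phi$ is positive definite, $\gamma^{(k)}\in[0,1]$ for all $k$, and $\sum_k\gamma^{(k)}(1-\gamma^{(k)})=+\infty$. Then, from every initial point, the algorithm can be carried out, and every sequence $(\psi^{(k)})_{k\ge1}$ that it generates converges to some $\psi^*=[x^*;\sigma^*;\lambda^*;\omega^*]$ with $0\in T\psi^*$; in particular $x^{(k)}\to x^*$, and $x^*$ is a minimizer of (P). -/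

import Mathlib

open Filter Topology
open scoped Matrix Kronecker

noncomputable section

/-! ### Convex analysis on real coordinate spaces -/

/-- Effective domain of an extended-real-valued function. -/
def effDom {α : Type*} (f : α → EReal) : Set α := {z | f z < ⊤}

/-- Indicator function of a set in the sense of convex analysis. -/
def iota {α : Type*} (S : Set α) (z : α) : EReal :=
  open Classical in if z ∈ S then 0 else ⊤

/-- Closed convex proper functions with values in `ℝ ∪ {+∞}`: the epigraph is closed and convex,
the value `-∞` is never taken, and the function is not identically `+∞`. -/
structure IsCCP {α : Type*} [AddCommGroup α] [Module ℝ α] [TopologicalSpace α]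
    (f : α → EReal) : Prop where
  convex_epi : Convex ℝ {p : α × ℝ | f p.1 ≤ (p.2 : EReal)}
  closed_epi : IsClosed {p : α × ℝ | f p.1 ≤ (p.2 : EReal)}
  ne_bot : ∀ z, f z ≠ ⊥
  proper : ∃ z, f z ≠ ⊤

/-- Subdifferential of a function on the Euclidean space `ℝ^ι`. -/
def subdiff {ι : Type*} [Fintype ι] (f : (ι → ℝ) → EReal) (z : ι → ℝ) : Set (ι → ℝ) :=
  {g | ∀ w, f z + ((g ⬝ᵥ (w - z) : ℝ) : EReal) ≤ f w}

/-- Zero set of a set-valued operator. -/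
def zer {ι : Type*} (T : (ι → ℝ) → Set (ι → ℝ)) : Set (ι → ℝ) := {z | (0 : ι → ℝ) ∈ T z}

/-- Squared Euclidean norm. -/
def sqNorm {ι : Type*} [Fintype ι] (v : ι → ℝ) : ℝ := v ⬝ᵥ v

/-! ### The multi-agent problem and its communication network -/

/-- The data: agents `Fin N`, decisions `x_i ∈ ℝ^(n i)`, `l` shared resources, coupling matrices
`A i`, availability `c`, local feasible sets `X i`, objectives `J i (x_i, s_i)`, directed edges
`(tail, head)` of the communication graph, and the weight matrix `W`. -/
structure Network (N l : ℕ) (n : Fin N → ℕ) where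
  A : (i : Fin N) → Matrix (Fin l) (Fin (n i)) ℝ
  c : Fin l → ℝ
  X : (i : Fin N) → Set (Fin (n i) → ℝ)
  J : (i : Fin N) → (Fin (n i) → ℝ) × (Fin l → ℝ) → EReal
  E : Finset (Fin N × Fin N)
  W : Matrix (Fin N) (Fin N) ℝ

namespace Network

variable {N l : ℕ} {n : Fin N → ℕ} (P : Network N l n)

/-- The aggregate `s_i(x_{-i}) = ∑_{j ≠ i} A_j x_j`. -/
def aggregate (x : (i : Fin N) → Fin (n i) → ℝ) (i : Fin N) : Fin l → ℝ :=
  ∑ j ∈ Finset.univ.erase i, P.A j *ᵥ x j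

/-- The global objective `J(x) = ∑ i, J_i(x_i, s_i(x_{-i}))`. -/
def totalCost (x : (i : Fin N) → Fin (n i) → ℝ) : EReal :=
  ∑ i, P.J i (x i, P.aggregate x i)

/-- The global feasible set: `x_i ∈ X_i` for all `i` and `∑ i, A_i x_i ≤ c`. -/
def feasible : Set ((i : Fin N) → Fin (n i) → ℝ) :=
  {x | (∀ i, x i ∈ P.X i) ∧ ∑ i, P.A i *ᵥ x i ≤ P.c}

/-- Minimizers of the global problem. -/
def minimizers : Set ((i : Fin N) → Fin (n i) → ℝ) :=
  {x | x ∈ P.feasible ∧ P.totalCost x < ⊤ ∧ ∀ x' ∈ P.feasible, P.totalCost x ≤ P.totalCost x'}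

/-- A Slater point of the problem with extended-real-valued objectives: the coupling inequality is
strict and the point is relatively interior to the domains of the objectives and to the local
feasible sets. Objectives that are only defined on `X_i × ℝ^l` are extended by `+∞`; then
`dom J_i ⊆ X_i × ℝ^l`, and the domain of `J_i` already accounts for the set `X_i`.
If `dom J_i = X_i × ℝ^l` for every `i`, or if every `J_i` is finite everywhere, a Slater point
exists if and only if some `x` with `x_i ∈ X_i` has `∑ i, A_i x_i < c` in every coordinate. -/
structure IsSlaterPoint (x : (i : Fin N) → Fin (n i) → ℝ) : Prop where
  mem : ∀ i, x i ∈ P.X i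
  strict : ∀ a, (∑ i, P.A i *ᵥ x i) a < P.c a
  mem_ri_dom : ∀ i, (x i, P.aggregate x i) ∈ intrinsicInterior ℝ (effDom (P.J i))
  mem_ri_set : ∀ i, effDom (P.J i) ⊆ P.X i ×ˢ Set.univ ∨ x i ∈ intrinsicInterior ℝ (P.X i)

/-- Assumption on the feasible sets: nonempty, closed, convex, with Slater's condition. -/
structure FeasibleSetsRegular : Prop where
  nonempty : ∀ i, (P.X i).Nonempty
  closed : ∀ i, IsClosed (P.X i)
  convex : ∀ i, Convex ℝ (P.X i)
  slater : ∃ x, P.IsSlaterPoint x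

/-- Assumption on the communication graph: undirected (the set of directed edges is symmetric),
connected, without self-loops, and every agent has an out-neighbour. -/
structure Communicable : Prop where
  symm : ∀ i j, (i, j) ∈ P.E → (j, i) ∈ P.E
  connected : (SimpleGraph.fromRel fun i j => (i, j) ∈ P.E).Connected
  no_loops : ∀ i, (i, i) ∉ P.E
  out_nonempty : ∀ i, ∃ j, (i, j) ∈ P.E

/-- `W` is a weight matrix of the communication graph; it need not be symmetric. -/
structure IsWeighted : Prop where
  neg : ∀ i j, (i, j) ∈ P.E → P.W i j < 0
  zero : ∀ i j, i ≠ j → (i, j) ∉ P.E → P.W i j = 0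
  diag : ∀ i, P.W i i = -∑ j ∈ Finset.univ.erase i, P.W i j

/-! ### The stacked variable `ψ = [x; σ; λ; ω]` -/

/-- Directed edges `(tail, head)`. -/
abbrev Edge : Type := {e : Fin N × Fin N // e ∈ P.E}

/-- In-edges of agent `i`, that is, the edges `(j, i)` with `j` an in-neighbour of `i`. -/
abbrev InEdge (i : Fin N) : Type := {e : P.Edge // e.1.2 = i}

/-- Scalar components of `ω`: the `y_i` (agents), the `μ_{ij}` (edges), the `y_{ij}` (edges). -/
abbrev OmegaIdx : Type := Fin N ⊕ (P.Edge ⊕ P.Edge)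

/-- The agent `i` whose block `ω_i` contains a component: `y_i`, `μ_{ij}` and `y_{ij}` all belong
to `ω_i`. -/
def omegaOwner : P.OmegaIdx → Fin N
  | .inl i => i
  | .inr (.inl e) => e.1.1
  | .inr (.inr e) => e.1.1

/-- Coordinates of `ψ = [x; σ; λ; ω]`, grouped as `([x; σ]; [λ; ω])`. -/
abbrev Idx : Type :=
  ((Σ i : Fin N, Fin (n i)) ⊕ (Fin N × Fin l)) ⊕ ((P.Edge × Fin l) ⊕ (P.OmegaIdx × Fin l))

abbrev State : Type := P.Idx → ℝ

variable {P}

def xPart (ψ : P.State) (i : Fin N) : Fin (n i) → ℝ := fun a => ψ (.inl (.inl ⟨i, a⟩))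

def sigPart (ψ : P.State) (i : Fin N) : Fin l → ℝ := fun a => ψ (.inl (.inr (i, a)))

/-- `lamPart ψ e` is `λ_{ji}` for the edge `e = (j, i)`. -/
def lamPart (ψ : P.State) (e : P.Edge) : Fin l → ℝ := fun a => ψ (.inr (.inl (e, a)))

def yPart (ψ : P.State) (i : Fin N) : Fin l → ℝ := fun a => ψ (.inr (.inr (.inl i, a)))

/-- `muPart ψ e` is `μ_{ji}` for the edge `e = (j, i)`. -/
def muPart (ψ : P.State) (e : P.Edge) : Fin l → ℝ := fun a => ψ (.inr (.inr (.inr (.inl e), a)))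

/-- `yEdgePart ψ e` is `y_{ji}`, the estimate of `y_j` kept by agent `i`, for the edge
`e = (j, i)`. -/
def yEdgePart (ψ : P.State) (e : P.Edge) : Fin l → ℝ :=
  fun a => ψ (.inr (.inr (.inr (.inr e), a)))

/-- `λ_{iB} = ∑_{j ∈ N_i^+} λ_{ji} - ∑_{j ∈ N_i^-} λ_{ij}`. -/
def lamB (ψ : P.State) (i : Fin N) : Fin l → ℝ :=
  (∑ e : P.Edge, if e.1.2 = i then lamPart ψ e else 0) -
    ∑ e : P.Edge, if e.1.1 = i then lamPart ψ e else 0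

/-- `A_i x_i + σ_i - A_j x_j - σ_j` for the edge `e = (j, i)`. -/
def disagreement (ψ : P.State) (e : P.Edge) : Fin l → ℝ :=
  P.A e.1.2 *ᵥ xPart ψ e.1.2 + sigPart ψ e.1.2 - P.A e.1.1 *ᵥ xPart ψ e.1.1 - sigPart ψ e.1.1

variable (P)

/-! ### The operator `T` and the design matrix -/

/-- The block diagonal matrix of the `A_i`. -/
def bigA : Matrix (Fin N × Fin l) (Σ i : Fin N, Fin (n i)) ℝ :=
  Matrix.of fun p q => if p.1 = q.1 then P.A q.1 p.2 q.2 else 0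

/-- Incidence matrix: the column of an edge is `+1` at its head and `-1` at its tail. -/
def incidence : Matrix (Fin N) P.Edge ℝ :=
  Matrix.of fun i e => (if e.1.2 = i then 1 else 0) - (if e.1.1 = i then 1 else 0)

/-- `B_l = B ⊗ I_l`. -/
def Bl : Matrix (Fin N × Fin l) (P.Edge × Fin l) ℝ :=
  P.incidence ⊗ₖ (1 : Matrix (Fin l) (Fin l) ℝ)

/-- The skew-symmetric matrix `M_y'` (before the Kronecker product with `I_l`): row `y_i` is
`-∑_j μ_{ij}`, row `μ_{ij}` is `y_i - y_{ij}`, row `y_{ij}` is `μ_{ij}`. -/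
def My : Matrix P.OmegaIdx P.OmegaIdx ℝ :=
  Matrix.of fun r s =>
    match r, s with
    | .inl i, .inr (.inl e) => if e.1.1 = i then -1 else 0
    | .inr (.inl e), .inl i => if e.1.1 = i then 1 else 0
    | .inr (.inl e), .inr (.inr e') => if e = e' then -1 else 0
    | .inr (.inr e), .inr (.inl e') => if e = e' then 1 else 0
    | _, _ => 0

/-- The linear part of `T`. -/
def linT : Matrix P.Idx P.Idx ℝ :=
  Matrix.fromBlocks
    0 (Matrix.fromBlocks (P.bigAᵀ * P.Bl) 0 P.Bl 0)
    (Matrix.fromBlocks (-(P.Blᵀ * P.bigA)) (-P.Blᵀ) 0 0)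
    (Matrix.fromBlocks 0 0 0 (P.My ⊗ₖ (1 : Matrix (Fin l) (Fin l) ℝ)))

/-- `Q_i = {(x_i, σ_i) | A_i x_i + σ_i ≤ c}`. -/
def setQ (i : Fin N) : Set ((Fin (n i) → ℝ) × (Fin l → ℝ)) :=
  {z | P.A i *ᵥ z.1 + z.2 ≤ P.c}

/-- The variables `(x_i, σ_i, y_i, [y_{ji}]_{j ∈ N_i^+})` kept by agent `i`. -/
abbrev Local (i : Fin N) : Type :=
  (Fin (n i) → ℝ) × (Fin l → ℝ) × (Fin l → ℝ) × (P.InEdge i → Fin l → ℝ)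

/-- `F_i`: the relation `(N-1) A_i x_i - σ_i = W_ii y_i + ∑_{j ∈ N_i^+} W_ji y_{ji}`. -/
def setF (i : Fin N) : Set (P.Local i) :=
  {z | ((N : ℝ) - 1) • (P.A i *ᵥ z.1) - z.2.1 =
    P.W i i • z.2.2.1 + ∑ e : P.InEdge i, P.W e.1.1.1 i • z.2.2.2 e}

variable {P} in
/-- The variables of agent `i` within `ψ`. -/
def localPart (ψ : P.State) (i : Fin N) : P.Local i :=
  (xPart ψ i, sigPart ψ i, yPart ψ i, fun e => yEdgePart ψ e.1)

/-- `∑ i, (J_i(x_i, σ_i) + ι_{X_i}(x_i) + ι_{Q_i}(x_i, σ_i) + ι_{F_i}(x_i, σ_i, y_i))`. -/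
def convexPart (ψ : P.State) : EReal :=
  ∑ i, (P.J i (xPart ψ i, sigPart ψ i) + iota (P.X i) (xPart ψ i) +
    iota (P.setQ i) (xPart ψ i, sigPart ψ i) + iota (P.setF i) (localPart ψ i))

/-- The set-valued operator `T`. -/
def opT (ψ : P.State) : Set P.State :=
  {u | ∃ g ∈ subdiff P.convexPart ψ, u = g + P.linT *ᵥ ψ}

/-- Positive step sizes: `τ₁, τ₂, τ₄` per agent and `τ₃` per edge. -/
structure StepSizes where
  t1 : Fin N → ℝ
  t2 : Fin N → ℝ
  t3 : P.Edge → ℝ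
  t4 : Fin N → ℝ
  t1_pos : ∀ i, 0 < t1 i
  t2_pos : ∀ i, 0 < t2 i
  t3_pos : ∀ e, 0 < t3 e
  t4_pos : ∀ i, 0 < t4 i

variable {P}

/-- The design matrix `Φ`. -/
def designMatrix (τ : P.StepSizes) : Matrix P.Idx P.Idx ℝ :=
  Matrix.fromBlocks
    (Matrix.fromBlocks (Matrix.diagonal fun q => (τ.t1 q.1)⁻¹) 0
      0 (Matrix.diagonal fun q => (τ.t2 q.1)⁻¹))
    (Matrix.fromBlocks (-((1 / 2 : ℝ) • (P.bigAᵀ * P.Bl))) 0 (-((1 / 2 : ℝ) • P.Bl)) 0)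
    (Matrix.fromBlocks (-((1 / 2 : ℝ) • (P.Blᵀ * P.bigA))) (-((1 / 2 : ℝ) • P.Blᵀ)) 0 0)
    (Matrix.fromBlocks (Matrix.diagonal fun q => (τ.t3 q.1)⁻¹) 0
      0 (Matrix.diagonal fun q => (τ.t4 (P.omegaOwner q.1))⁻¹))

/-! ### The algorithm -/

/-- The subroutine that computes `y_i`, `μ_{ji}`, `y_{ji}` of the state `ψ` from those of `ψt`. -/
structure AuxConsensusUpdate (τ : P.StepSizes) (ψt ψ : P.State) : Prop where
  y : ∀ i, yPart ψ i =
    ((1 + τ.t4 i ^ 2) /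
        (1 + τ.t4 i ^ 2 * (1 + ((Finset.univ.filter fun e : P.Edge => e.1.1 = i).card : ℝ)))) •
      (yPart ψt i + (τ.t4 i / (1 + τ.t4 i ^ 2)) •
        ∑ e : P.Edge, if e.1.1 = i then muPart ψt e + τ.t4 i • yEdgePart ψt e else 0)
  mu : ∀ e : P.Edge, muPart ψ e =
    (1 / (1 + τ.t4 e.1.1 ^ 2)) • muPart ψt e +
      (τ.t4 e.1.1 / (1 + τ.t4 e.1.1 ^ 2)) • (yEdgePart ψt e - yPart ψ e.1.1)
  yEdge : ∀ e : P.Edge, yEdgePart ψ e = yEdgePart ψt e - τ.t4 e.1.1 • muPart ψ e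

/-- The objective of the first local problem of agent `i`. -/
def localObjA (τ : P.StepSizes) (ψt : P.State) (i : Fin N)
    (z : (Fin (n i) → ℝ) × (Fin l → ℝ)) : EReal :=
  P.J i z + (((1 / 2) * (lamB ψt i ⬝ᵥ (P.A i *ᵥ z.1 + z.2)) +
    1 / (2 * τ.t1 i) * sqNorm (z.1 - xPart ψt i) +
    1 / (2 * τ.t2 i) * sqNorm (z.2 - sigPart ψt i) : ℝ) : EReal)

/-- The objective of the second local problem of agent `i`. The estimate `y_{ji}` is a component
of `ω_j`, so its step size in the design matrix is `τ_{4j}`. -/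
def localObjB (τ : P.StepSizes) (ψh : P.State) (i : Fin N) (z : P.Local i) : ℝ :=
  1 / (2 * τ.t1 i) * sqNorm (z.1 - (xPart ψh i - (τ.t1 i / 2) • ((P.A i)ᵀ *ᵥ lamB ψh i))) +
  1 / (2 * τ.t2 i) * sqNorm (z.2.1 - (sigPart ψh i - (τ.t2 i / 2) • lamB ψh i)) +
  1 / (2 * τ.t4 i) * sqNorm (z.2.2.1 - yPart ψh i) +
  ∑ e : P.InEdge i, 1 / (2 * τ.t4 e.1.1.1) * sqNorm (z.2.2.2 e - yEdgePart ψh e.1)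

variable (P) in
/-- The feasible set of the second local problem of agent `i`. -/
def localFeasB (i : Fin N) : Set (P.Local i) :=
  {z | z.1 ∈ P.X i ∧ z ∈ P.setF i ∧ P.A i *ᵥ z.1 + z.2.1 ≤ P.c}

/-- One iteration with relaxation parameter `γ`: from `ψt` (tilde), the state `ψ`, the reflected
state `ψh` (hat), the state `ψb` (bar), and the next `ψt'` (tilde). -/
structure Iteration (τ : P.StepSizes) (γ : ℝ) (ψt ψ ψh ψb ψt' : P.State) : Prop where
  acu : AuxConsensusUpdate τ ψt ψ
  argminA : ∀ i, IsMinOn (localObjA τ ψt i) Set.univ (xPart ψ i, sigPart ψ i)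
  reflect : ψh = (2 : ℝ) • ψ - ψt
  lam : ∀ e : P.Edge, lamPart ψ e = lamPart ψt e + ((1 / 2) * τ.t3 e) • disagreement ψh e
  feasB : ∀ i, localPart ψb i ∈ P.localFeasB i
  argminB : ∀ i, IsMinOn (localObjB τ ψh i) (P.localFeasB i) (localPart ψb i)
  lamBar : ∀ e : P.Edge, lamPart ψb e =
    lamPart ψh e + τ.t3 e • (disagreement ψb e - (1 / 2 : ℝ) • disagreement ψh e)
  muBar : ∀ e : P.Edge, muPart ψb e = muPart ψh e
  relax : ψt' = ψt + (2 * γ) • (ψb - ψ)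

/-- `ψ` is a sequence generated by the algorithm with step sizes `τ`, relaxation parameters `γ` and
initial state `ψ0`. The entry `ψ 0` is not produced by the algorithm and is arbitrary. -/
def IsGenerated (τ : P.StepSizes) (γ : ℕ → ℝ) (ψ0 : P.State) (ψ : ℕ → P.State) : Prop :=
  ∃ ψt ψh ψb : ℕ → P.State, ψt 0 = ψ0 ∧
    ∀ k, Iteration τ (γ k) (ψt k) (ψ (k + 1)) (ψh (k + 1)) (ψb (k + 1)) (ψt (k + 1))

end Network

end

/-! The linear part of `opT` splits as `skewA + skewB`: each summand carries half of the coupling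
between (x, σ) and λ, and `skewA` also carries all of the coupling inside ω. This gives two monotone
relations, `relA` (subgradients of ∑ J_i plus `skewA`) and `relB` (normals to the constraints X_i,
Q_i, F_i plus `skewB`). Every common zero p, with g in the first and -g in the second, is a zero of
`opT`.

The off-diagonal blocks of Φ are chosen so that Φ + `skewA` and Φ + `skewB` are block triangular
between (x, σ) and λ. The resolvents of both relations in the metric of Φ therefore reduce to local
minimizations followed by explicit updates, and these are the two halves of an iteration
(`FirstStep.relA`, `SecondStep.relB`). One iteration is z ↦ z + γ(Rz - z), with R the composition of
the two reflected resolvents. Monotonicity makes R nonexpansive for the inner product of Φ, so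
`tendsto_krasnoselskii_mann` yields a limit q of z with Rq = q. The first resolvent is also
nonexpansive, hence ψ converges to its value at q, which is a common zero
(`tendsto_relaxed_splitting`).

Two facts about the problem complete the argument. First, a common zero exists (`exists_zero`): a
minimizer of (P) lifts to a state in ker `linT`, Slater's condition allows a separation argument
that gives subgradients g₁, g₂ with g₁ + g₂ orthogonal to ker `linT`, and skew-symmetry turns g₁ +
g₂ into -`linT` ν, whose λ and μ components are the multipliers. Second, a common zero solves (P)
(`mem_minimizers`): its λ and μ rows express consensus, and consensus together with the F_i forces
σ_i to be the true aggregate because the kernel of W consists of the constant vectors. -/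

noncomputable section

/-! ### Separation in real vector spaces -/

section Separation

variable {E : Type*} [AddCommGroup E] [Module ℝ E]

/-- The pointed cone generated by a convex set containing the origin. -/
def coneOver (C : Set E) (hC : Convex ℝ C) (h0 : (0 : E) ∈ C) : PointedCone ℝ E where
  carrier := {p | ∃ r : ℝ, 0 ≤ r ∧ ∃ q ∈ C, p = r • q}
  zero_mem' := ⟨0, le_rfl, 0, h0, by simp⟩
  smul_mem' := by
    rintro ⟨c, hc⟩ p ⟨r, hr, q, hq, rfl⟩
    exact ⟨c * r, mul_nonneg hc hr, q, hq, by rw [mul_smul]; rfl⟩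
  add_mem' := by
    rintro p p' ⟨r, hr, q, hq, rfl⟩ ⟨r', hr', q', hq', rfl⟩
    rcases hr.eq_or_lt with h | h
    · exact ⟨r', hr', q', hq', by simp [← h]⟩
    have hs : 0 < r + r' := by linarith
    refine ⟨r + r', hs.le, (r / (r + r')) • q + (r' / (r + r')) • q',
      hC hq hq' (by positivity) (by positivity) (by field_simp), ?_⟩
    rw [smul_add, smul_smul, smul_smul, mul_div_cancel₀ _ hs.ne', mul_div_cancel₀ _ hs.ne']

/-- This is the M. Riesz extension theorem: (d, t) ↦ t on D × ℝ is nonnegative on the cone over C by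
`hmin`, and `habs` supplies the cofinality required to extend it to a functional g that is
nonnegative on the whole cone. Then φ = -g(·, 0). -/
theorem exists_linear_le_of_absorbing (C : Set (E × ℝ)) (hC : Convex ℝ C) (h0 : (0 : E × ℝ) ∈ C)
    (D : Submodule ℝ E) (hmin : ∀ w t, (w, t) ∈ C → w ∈ D → 0 ≤ t)
    (habs : ∀ u : E, ∃ ε : ℝ, 0 < ε ∧ ∃ d ∈ D, ∃ t, (d + ε • u, t) ∈ C) :
    ∃ φ : E →ₗ[ℝ] ℝ, (∀ d ∈ D, φ d = 0) ∧ ∀ w t, (w, t) ∈ C → φ w ≤ t := by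
  let f : (E × ℝ) →ₗ.[ℝ] ℝ :=
    ⟨D.prod ⊤, (LinearMap.snd ℝ E ℝ).comp (D.prod ⊤).subtype⟩
  obtain ⟨g, hgf, hgs⟩ := riesz_extension (coneOver C hC h0) f
    (by
      rintro ⟨⟨d, t⟩, hd⟩ ⟨r, hr, ⟨w, s⟩, hq, hp⟩
      simp only [Prod.smul_mk, Prod.mk.injEq] at hp
      obtain ⟨rfl, rfl⟩ := hp
      change 0 ≤ r • s
      rcases hr.eq_or_lt with h | h
      · simp [← h]
      have hw : w ∈ D := by
        have : r • w ∈ D := hd.1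
        simpa [smul_smul, inv_mul_cancel₀ h.ne'] using D.smul_mem r⁻¹ this
      exact mul_nonneg hr (hmin w s hq hw))
    (by
      rintro ⟨u, s⟩
      obtain ⟨ε, hε, d, hd, t, ht⟩ := habs u
      -- The witness is chosen so that adding (u, s) gives ε⁻¹ • (d + ε • u, t), a point of the
      -- cone.
      refine ⟨⟨(ε⁻¹ • d, ε⁻¹ * t - s), D.smul_mem _ hd, trivial⟩, ε⁻¹, by positivity,
        (d + ε • u, t), ht, ?_⟩
      simp [smul_smul, inv_mul_cancel₀ hε.ne'])
  refine ⟨-(g.comp (LinearMap.inl ℝ E ℝ)), fun d hd => ?_, fun w t hwt => ?_⟩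
  · have := hgf ⟨(d, 0), hd, trivial⟩
    simp only [LinearMap.neg_apply, LinearMap.comp_apply, LinearMap.inl_apply, this]
    change -(0 : ℝ) = 0
    simp
  · have h1 := hgs (w, t) ⟨1, zero_le_one, _, hwt, by simp⟩
    have h2 : g (0, t) = t := hgf ⟨(0, t), D.zero_mem, trivial⟩
    have h3 : g (w, t) = g (w, 0) + g (0, t) := by rw [← map_add]; simp
    simp only [LinearMap.neg_apply, LinearMap.comp_apply, LinearMap.inl_apply]
    linarith

/-- Every segment in `S` that ends at `z` can be prolonged beyond `z` within `S`. -/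
structure Prolongable (S : Set E) (z : E) : Prop where
  mem : z ∈ S
  prolong : ∀ w ∈ S, ∃ ε : ℝ, 0 < ε ∧ z - ε • (w - z) ∈ S

theorem Convex.add_smul_mem_of_le {S : Set E} (hS : Convex ℝ S) {z u : E} {ε δ : ℝ} (hz : z ∈ S)
    (hu : z + ε • u ∈ S) (hδ : 0 ≤ δ) (hδε : δ ≤ ε) : z + δ • u ∈ S := by
  rcases hδ.eq_or_lt with h | h
  · simpa [← h] using hz
  have hε : 0 < ε := h.trans_le hδε
  have := hS.add_smul_mem hz hu (t := δ / ε) ⟨by positivity, (div_le_one hε).2 hδε⟩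
  rwa [smul_smul, div_mul_cancel₀ _ hε.ne'] at this

theorem Convex.sub_smul_mem_of_le {S : Set E} (hS : Convex ℝ S) {z u : E} {ε δ : ℝ} (hz : z ∈ S)
    (hu : z - ε • u ∈ S) (hδ : 0 ≤ δ) (hδε : δ ≤ ε) : z - δ • u ∈ S := by
  rw [sub_eq_add_neg, ← smul_neg] at *
  exact hS.add_smul_mem_of_le hz hu hδ hδε

/-- The directions in which S can be entered from z are stable under addition by convexity and under
negation by prolongation, so they form a subspace. -/
theorem Prolongable.exists_add_smul_mem {S : Set E} (hS : Convex ℝ S) {z : E}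
    (hz : Prolongable S z) {u : E} (hu : u ∈ Submodule.span ℝ ((fun w => w - z) '' S)) :
    ∃ ε : ℝ, 0 < ε ∧ z + ε • u ∈ S := by
  induction hu using Submodule.span_induction with
  | mem x hx =>
    obtain ⟨w, hw, rfl⟩ := hx
    exact ⟨1, one_pos, by simpa using hw⟩
  | zero => exact ⟨1, one_pos, by simpa using hz.mem⟩
  | add x y _ _ hx hy =>
    obtain ⟨ε, hε, hx⟩ := hx
    obtain ⟨δ, hδ, hy⟩ := hy
    have h1 := hS.add_smul_mem_of_le hz.mem hx (le_min hε.le hδ.le) (min_le_left _ _)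
    have h2 := hS.add_smul_mem_of_le hz.mem hy (le_min hε.le hδ.le) (min_le_right _ _)
    refine ⟨min ε δ / 2, by positivity, ?_⟩
    convert hS h1 h2 (a := 1 / 2) (b := 1 / 2) (by norm_num) (by norm_num) (by norm_num) using 1
    module
  | smul a x _ hx =>
    obtain ⟨ε, hε, hx⟩ := hx
    rcases lt_trichotomy a 0 with ha | rfl | ha
    · obtain ⟨δ, hδ, h⟩ := hz.prolong _ hx
      refine ⟨δ * ε / -a, by have : 0 < -a := by linarith
                             positivity, ?_⟩
      convert h using 1
      rw [smul_smul, add_sub_cancel_left, smul_smul, sub_eq_add_neg, ← neg_smul]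
      congr 2
      have := ha.ne
      field_simp
    · exact ⟨1, one_pos, by simpa using hz.mem⟩
    · refine ⟨ε / a, by positivity, ?_⟩
      rwa [smul_smul, div_mul_cancel₀ _ ha.ne']

/-- A subgradient, orthogonal to `D`, of a convex function (given by its epigraph `C`) at a
minimizer `z` over the affine subspace `z + D`, provided that this subspace contains a relatively
interior point of the domain. -/
theorem exists_linear_le_of_min (C : Set (E × ℝ)) (hC : Convex ℝ C) (D : Submodule ℝ E)
    {z : E} {a : ℝ} (hz : (z, a) ∈ C) (hmin : ∀ w t, (w, t) ∈ C → w - z ∈ D → a ≤ t)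
    {b : E} (hb : b - z ∈ D) (hri : Prolongable (Prod.fst '' C) b) :
    ∃ φ : E →ₗ[ℝ] ℝ, (∀ d ∈ D, φ d = 0) ∧ ∀ w t, (w, t) ∈ C → φ (w - z) ≤ t - a := by
  have hS : Convex ℝ (Prod.fst '' C) := hC.linear_image (LinearMap.fst ℝ E ℝ)
  -- The domain absorbs, modulo D, only directions in V, so the separation takes place in V, with
  -- the origin moved to (z, a), and the functional is extended to E afterwards.
  set U := Submodule.span ℝ ((fun w => w - b) '' (Prod.fst '' C))
  let V : Submodule ℝ E := U ⊔ D
  have hzV : ∀ w t, (w, t) ∈ C → w - z ∈ V := fun w t hwt => by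
    have h1 : w - b ∈ U := Submodule.subset_span ⟨w, ⟨_, hwt, rfl⟩, rfl⟩
    have := V.add_mem (Submodule.mem_sup_left h1) (Submodule.mem_sup_right hb)
    simpa using this
  let C' : Set (V × ℝ) := {p | (z + (p.1 : E), a + p.2) ∈ C}
  have hC' : Convex ℝ C' := by
    intro p hp q hq s t hs ht hst
    have := hC hp hq hs ht hst
    change (_, _) ∈ C
    convert this using 1
    ext
    · simp only [Prod.fst_add, Prod.smul_fst, Submodule.coe_add, Submodule.coe_smul, smul_add]
      nth_rewrite 1 [← one_smul ℝ z]
      rw [← hst]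
      module
    · simp only [Prod.snd_add, Prod.smul_snd, smul_eq_mul]
      linear_combination -a * hst
  obtain ⟨φ, hφD, hφ⟩ := exists_linear_le_of_absorbing C' hC' (by simpa [C'] using hz)
    (D.comap V.subtype)
    (fun w t hwt hw => by
      have := hmin _ _ hwt (by simpa using hw)
      linarith)
    (by
      rintro ⟨u, hu⟩
      obtain ⟨u₁, hu₁, d, hd, rfl⟩ := Submodule.mem_sup.1 hu
      obtain ⟨ε, hε, ⟨_, t⟩, ht, rfl⟩ := hri.exists_add_smul_mem hS hu₁
      -- The correction in D moves the base point from z to b and cancels ε • d, leaving b + ε • u₁,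
      -- which lies in the domain.
      refine ⟨ε, hε, ⟨b - z - ε • d, Submodule.mem_sup_right (D.sub_mem hb (D.smul_mem _ hd))⟩,
        D.sub_mem hb (D.smul_mem _ hd), t - a, ?_⟩
      change (_, _) ∈ C
      convert ht using 1
      ext
      · simp
        module
      · simp)
  obtain ⟨φ', hφ'⟩ := φ.exists_extend
  have key : ∀ v (hv : v ∈ V), φ' v = φ ⟨v, hv⟩ := fun v hv => by rw [← hφ']; rfl
  refine ⟨φ', fun d hd => ?_, fun w t hwt => ?_⟩
  · rw [key d (Submodule.mem_sup_right hd)]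
    exact hφD _ hd
  · rw [key _ (hzV w t hwt)]
    exact hφ _ _ (by simpa [C'] using hwt)

end Separation

/-- The line through w and z stays in the affine span, where S is a neighbourhood of z. -/
theorem Prolongable.of_mem_intrinsicInterior {E : Type*} [NormedAddCommGroup E] [NormedSpace ℝ E]
    {S : Set E} {z : E} (hz : z ∈ intrinsicInterior ℝ S) : Prolongable S z := by
  refine ⟨intrinsicInterior_subset hz, fun w hw => ?_⟩
  obtain ⟨y, hy, rfl⟩ := mem_intrinsicInterior.1 hz
  have hw' : w ∈ affineSpan ℝ S := subset_affineSpan ℝ S hw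
  have hmem : ∀ ε : ℝ, (y : E) - ε • (w - y) ∈ affineSpan ℝ S := fun ε => by
    have := AffineMap.lineMap_mem (-ε) y.2 hw'
    rw [AffineMap.lineMap_apply, vsub_eq_sub, vadd_eq_add] at this
    convert this using 1
    module
  let c : ℝ → affineSpan ℝ S := fun ε => ⟨y - ε • (w - y), hmem ε⟩
  have hc : Continuous c := by
    refine Continuous.subtype_mk ?_ _
    fun_prop
  have h0 : c 0 = y := Subtype.ext (by simp [c])
  have h1 : ∀ᶠ ε in 𝓝 (0 : ℝ), c ε ∈ ((↑) ⁻¹' S : Set (affineSpan ℝ S)) :=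
    hc.continuousAt.eventually_mem (by rw [h0]; exact mem_interior_iff_mem_nhds.1 hy)
  obtain ⟨ε, hε, hε'⟩ := ((h1.filter_mono nhdsWithin_le_nhds).and
    (self_mem_nhdsWithin : Set.Ioi (0 : ℝ) ∈ 𝓝[>] 0)).exists
  exact ⟨ε, hε', hε⟩

/-! ### Minimization of strongly convex quadratic perturbations -/

/-- `h` is quadratic: it has the linear part `grad z` at `z` and the homogeneous quadratic
part `q`. -/
structure IsQuadratic {E : Type*} [AddCommGroup E] [Module ℝ E] (h : E → ℝ)
    (grad : E → E →ₗ[ℝ] ℝ) (q : E → ℝ) : Prop where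
  expand : ∀ z d, h (z + d) = h z + grad z d + q d
  smul : ∀ (t : ℝ) d, q (t • d) = t ^ 2 * q d

/-- The first-order optimality condition over a convex subset of `E × ℝ`. -/
theorem IsQuadratic.variational_inequality {E : Type*} [AddCommGroup E] [Module ℝ E]
    {h : E → ℝ} {grad : E → E →ₗ[ℝ] ℝ} {q : E → ℝ} (hq : IsQuadratic h grad q)
    {C : Set (E × ℝ)} (hC : Convex ℝ C) {z : E} {a : ℝ} (hz : (z, a) ∈ C)
    (hmin : ∀ w t, (w, t) ∈ C → a + h z ≤ t + h w) {w : E} {t : ℝ} (hw : (w, t) ∈ C) :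
    a ≤ t + grad z (w - z) := by
  by_contra hcon
  push Not at hcon
  -- Minimality is tested along the segment towards (w, t) and divided by s; the quadratic term then
  -- vanishes as s → 0.
  have key : ∀ s : ℝ, 0 < s → s ≤ 1 → 0 ≤ t - a + grad z (w - z) + s * q (w - z) := by
    intro s hs hs1
    have h1 := hC.add_smul_sub_mem hz hw ⟨hs.le, hs1⟩
    have h2 := hmin _ _ h1
    simp only [Prod.fst_sub, Prod.snd_sub, Prod.smul_fst, Prod.smul_snd, smul_eq_mul] at h2
    rw [hq.expand, hq.smul, map_smul, smul_eq_mul] at h2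
    have h3 : 0 ≤ s * (t - a + grad z (w - z) + s * q (w - z)) := by nlinarith
    exact nonneg_of_mul_nonneg_right h3 hs
  have hlim : Tendsto (fun s : ℝ => t - a + grad z (w - z) + s * q (w - z)) (𝓝[>] 0)
      (𝓝 (t - a + grad z (w - z) + 0 * q (w - z))) := by
    apply Tendsto.mono_left _ nhdsWithin_le_nhds
    exact Continuous.tendsto (by fun_prop) 0
  have := ge_of_tendsto hlim (by
    filter_upwards [Ioc_mem_nhdsGT (zero_lt_one (α := ℝ))] with s hs using key s hs.1 hs.2)
  linarith

/-- A quadratic function with positive definite quadratic part attains its minimum, jointly with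
the last coordinate, on a closed subset of `E × ℝ` that has an affine minorant. -/
theorem IsQuadratic.exists_min {E : Type*} [NormedAddCommGroup E] [NormedSpace ℝ E]
    [FiniteDimensional ℝ E] {h : E → ℝ} {grad : E → E →ₗ[ℝ] ℝ} {q : E → ℝ}
    (hq : IsQuadratic h grad q) (hc : Continuous h) {κ : ℝ} (hκ : 0 < κ)
    (hpos : ∀ d, κ * ‖d‖ ^ 2 ≤ q d)
    {C : Set (E × ℝ)} (hC : IsClosed C) (hne : C.Nonempty) {φ : E →ₗ[ℝ] ℝ} {b : ℝ}
    (hφ : ∀ w t, (w, t) ∈ C → φ w + b ≤ t) :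
    ∃ z a, (z, a) ∈ C ∧ ∀ w t, (w, t) ∈ C → a + h z ≤ t + h w := by
  obtain ⟨⟨w₀, t₀⟩, h₀⟩ := hne
  let ℓ : E →L[ℝ] ℝ := LinearMap.toContinuousLinearMap (φ + grad 0)
  have hgrow : ∀ w, h 0 + grad 0 w + κ * ‖w‖ ^ 2 ≤ h w := fun w => by
    have := hq.expand 0 w
    rw [zero_add] at this
    linarith [hpos w]
  have hℓ : ∀ w, -(‖ℓ‖ * ‖w‖) ≤ φ w + grad 0 w := fun w => by
    have := (abs_le.1 ((Real.norm_eq_abs _) ▸ ℓ.le_opNorm w)).1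
    simpa [ℓ] using this
  set m := t₀ + h w₀
  have hcont : Continuous fun p : E × ℝ => p.2 + h p.1 := by fun_prop
  let K : Set (E × ℝ) := C ∩ {p | p.2 + h p.1 ≤ m}
  have hKc : IsClosed K := hC.inter (isClosed_le hcont continuous_const)
  obtain ⟨R, hR⟩ : ∃ R, ∀ p ∈ K, ‖p.1‖ ≤ R := by
    -- Outside this radius κ‖w‖² exceeds ‖ℓ‖‖w‖ + |m - b - h 0|; the summand 1 gives ‖w‖ ≥ 1, which
    -- absorbs the constant term.
    refine ⟨(‖ℓ‖ + |m - b - h 0|) / κ + 1, fun p hp => ?_⟩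
    have h1 := hφ p.1 p.2 hp.1
    have h2 : p.2 + h p.1 ≤ m := hp.2
    have h3 := hgrow p.1
    have h4 := hℓ p.1
    by_contra hcon
    push Not at hcon
    have h5 : 1 ≤ ‖p.1‖ := by
      have : 0 ≤ (‖ℓ‖ + |m - b - h 0|) / κ := by positivity
      linarith
    have h6 : ‖ℓ‖ + |m - b - h 0| < κ * ‖p.1‖ := by
      have : (‖ℓ‖ + |m - b - h 0|) / κ < ‖p.1‖ := by linarith
      rwa [div_lt_iff₀ hκ, mul_comm] at this
    have h7 := le_abs_self (m - b - h 0)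
    have h8 := abs_nonneg (m - b - h 0)
    nlinarith
  -- On K the last coordinate lies between φ w + b and m - h w, so bounds for h and φ on the ball
  -- make K bounded.
  obtain ⟨B, hB⟩ : ∃ B, ∀ w : E, ‖w‖ ≤ R → |h w| + |φ w| ≤ B := by
    have hφc : Continuous φ := φ.continuous_of_finiteDimensional
    obtain ⟨B, hB⟩ := (isCompact_closedBall (0 : E) R).bddAbove_image
      (f := fun w => |h w| + |φ w|) (by fun_prop)
    exact ⟨B, fun w hw => hB ⟨w, by simpa using hw, rfl⟩⟩
  have hKb : Bornology.IsBounded K := by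
    refine (Metric.isBounded_closedBall (x := (0 : E × ℝ))
      (r := max R (B + |b| + |m|))).subset fun p hp => ?_
    have h1 := hφ p.1 p.2 hp.1
    have h2 : p.2 + h p.1 ≤ m := hp.2
    have h3 := hB _ (hR p hp)
    rw [mem_closedBall_zero_iff, Prod.norm_def]
    refine max_le_max (hR p hp) ?_
    rw [Real.norm_eq_abs, abs_le]
    constructor <;>
    linarith [neg_abs_le (h p.1), neg_abs_le (φ p.1), abs_nonneg (h p.1), abs_nonneg (φ p.1),
      neg_abs_le b, le_abs_self m, abs_nonneg b, abs_nonneg m]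
  obtain ⟨p, hpK, hp⟩ := (Metric.isCompact_of_isClosed_isBounded hKc hKb).exists_isMinOn
    ⟨(w₀, t₀), h₀, le_refl (t₀ + h w₀)⟩ hcont.continuousOn
  refine ⟨p.1, p.2, hpK.1, fun w t hwt => ?_⟩
  by_cases hm : t + h w ≤ m
  · exact hp (show (w, t) ∈ K from ⟨hwt, hm⟩)
  · exact hpK.2.trans (not_le.1 hm).le

/-! ### Krasnoselskii-Mann iteration -/

theorem norm_sq_add_smul_sub {H : Type*} [NormedAddCommGroup H] [InnerProductSpace ℝ H]
    (u v : H) (t : ℝ) :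
    ‖u + t • (v - u)‖ ^ 2 = (1 - t) * ‖u‖ ^ 2 + t * ‖v‖ ^ 2 - t * (1 - t) * ‖v - u‖ ^ 2 := by
  simp only [← real_inner_self_eq_norm_sq, inner_add_left, inner_add_right, inner_sub_left,
    inner_sub_right, real_inner_smul_left, real_inner_smul_right, real_inner_comm u v]
  ring

/-- The Krasnoselskii-Mann iteration of a nonexpansive map with a fixed point converges to a
fixed point. -/
theorem tendsto_krasnoselskii_mann {H : Type*} [NormedAddCommGroup H] [InnerProductSpace ℝ H]
    [ProperSpace H] {R : H → H} (hR : ∀ x y, ‖R x - R y‖ ≤ ‖x - y‖) (hfix : ∃ p, R p = p)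
    {γ : ℕ → ℝ} (hγ : ∀ k, γ k ∈ Set.Icc (0 : ℝ) 1)
    (hγsum : Tendsto (fun m => ∑ k ∈ Finset.range m, γ k * (1 - γ k)) atTop atTop)
    {z : ℕ → H} (hz : ∀ k, z (k + 1) = z k + γ k • (R (z k) - z k)) :
    ∃ p, R p = p ∧ Tendsto z atTop (𝓝 p) := by
  have hstep : ∀ p, R p = p → ∀ k, ‖z (k + 1) - p‖ ^ 2 ≤
      ‖z k - p‖ ^ 2 - γ k * (1 - γ k) * ‖R (z k) - z k‖ ^ 2 := by
    intro p hp k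
    have h1 := norm_sq_add_smul_sub (z k - p) (R (z k) - p) (γ k)
    rw [sub_sub_sub_cancel_right] at h1
    have h2 : z k - p + γ k • (R (z k) - z k) = z (k + 1) - p := by rw [hz]; abel
    rw [h2] at h1
    have h3 : ‖R (z k) - p‖ ≤ ‖z k - p‖ := by simpa [hp] using hR (z k) p
    have h4 : ‖R (z k) - p‖ ^ 2 ≤ ‖z k - p‖ ^ 2 := by gcongr
    nlinarith [(hγ k).1]
  have hfej : ∀ p, R p = p → Antitone fun k => ‖z k - p‖ := by
    intro p hp
    refine antitone_nat_of_succ_le fun k => ?_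
    refine (sq_le_sq₀ (norm_nonneg _) (norm_nonneg _)).1 ((hstep p hp k).trans ?_)
    have := (hγ k).1
    have : 0 ≤ 1 - γ k := by linarith [(hγ k).2]
    have : 0 ≤ γ k * (1 - γ k) * ‖R (z k) - z k‖ ^ 2 := by positivity
    linarith
  have hres : Antitone fun k => ‖R (z k) - z k‖ := by
    refine antitone_nat_of_succ_le fun k => ?_
    -- The iterate has moved the fraction γ of the way to R (z k). The two terms have norm at most γ
    -- and 1 - γ times the old residual.
    have h1 : R (z (k + 1)) - z (k + 1) =
        (R (z (k + 1)) - R (z k)) + (1 - γ k) • (R (z k) - z k) := by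
      nth_rewrite 2 [hz k]
      module
    have h2 : ‖R (z (k + 1)) - R (z k)‖ ≤ γ k * ‖R (z k) - z k‖ := by
      refine (hR _ _).trans_eq ?_
      rw [hz k, add_sub_cancel_left, norm_smul, Real.norm_of_nonneg (hγ k).1]
    have h3 : ‖(1 - γ k) • (R (z k) - z k)‖ = (1 - γ k) * ‖R (z k) - z k‖ := by
      rw [norm_smul, Real.norm_of_nonneg (by linarith [(hγ k).2])]
    rw [h1]
    refine (norm_add_le _ _).trans ?_
    linarith
  obtain ⟨p₀, hp₀⟩ := hfix
  have hres0 : ∀ ε > 0, ∃ k, ‖R (z k) - z k‖ < ε := by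
    intro ε hε
    by_contra! hcon
    -- A residual bounded below by ε would, by telescoping `hstep`, bound the divergent series by ‖z
    -- 0 - p₀‖² / ε².
    have hbound : ∀ m, (∑ k ∈ Finset.range m, γ k * (1 - γ k)) * ε ^ 2 ≤
        ‖z 0 - p₀‖ ^ 2 - ‖z m - p₀‖ ^ 2 := by
      intro m
      induction m with
      | zero => simp
      | succ m ih =>
        rw [Finset.sum_range_succ, add_mul]
        have h1 := hstep p₀ hp₀ m
        have h2 : ε ^ 2 ≤ ‖R (z m) - z m‖ ^ 2 := by gcongr; exact hcon m
        have h3 : 0 ≤ γ m * (1 - γ m) :=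
          mul_nonneg (hγ m).1 (by linarith [(hγ m).2])
        nlinarith
    obtain ⟨m, hm⟩ := (hγsum.eventually_gt_atTop (‖z 0 - p₀‖ ^ 2 / ε ^ 2)).exists
    rw [div_lt_iff₀ (by positivity)] at hm
    linarith [hbound m, sq_nonneg ‖z m - p₀‖]
  have hrest : Tendsto (fun k => R (z k) - z k) atTop (𝓝 0) := by
    rw [Metric.tendsto_atTop]
    intro ε hε
    obtain ⟨k, hk⟩ := hres0 ε hε
    exact ⟨k, fun j hj => by simpa using (hres hj).trans_lt hk⟩
  have hRc : Continuous R :=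
    (LipschitzWith.of_dist_le_mul (K := 1) fun x y => by
      simpa [dist_eq_norm] using hR x y).continuous
  obtain ⟨p, -, s, hs, hsp⟩ := tendsto_subseq_of_bounded
    (Metric.isBounded_closedBall (x := p₀) (r := ‖z 0 - p₀‖)) (x := z)
    (fun k => by simpa [dist_eq_norm] using hfej p₀ hp₀ (Nat.zero_le k))
  have hp : R p = p := by
    have h1 : Tendsto (fun k => R (z (s k)) - z (s k)) atTop (𝓝 (R p - p)) :=
      ((hRc.tendsto p).comp hsp).sub hsp
    have h2 := hrest.comp hs.tendsto_atTop
    exact sub_eq_zero.1 (tendsto_nhds_unique h1 h2)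
  refine ⟨p, hp, ?_⟩
  rw [Metric.tendsto_atTop] at hsp ⊢
  intro ε hε
  obtain ⟨k, hk⟩ := hsp ε hε
  -- The cluster point p is itself a fixed point, so the distance to p is antitone and one close
  -- iterate controls all later ones.
  refine ⟨s k, fun j hj => ?_⟩
  rw [dist_eq_norm]
  refine (hfej p hp hj).trans_lt ?_
  simpa [dist_eq_norm] using hk k le_rfl

/-! ### Relaxed operator splitting in the metric of a positive definite matrix -/

-- Factor Φ = BᵀB; positive definiteness makes B injective, and B serves as the isometry that
-- carries the Φ inner product to the Euclidean one.
open scoped MatrixOrder ComplexOrder in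
theorem Matrix.PosDef.exists_equiv_euclideanSpace {ι : Type*} [Fintype ι] [DecidableEq ι]
    {Φ : Matrix ι ι ℝ} (hΦ : Φ.PosDef) :
    ∃ e : (ι → ℝ) ≃L[ℝ] EuclideanSpace ℝ ι, ∀ u v, inner ℝ (e u) (e v) = u ⬝ᵥ Φ *ᵥ v := by
  obtain ⟨B, hB⟩ := CStarAlgebra.nonneg_iff_eq_star_mul_self.1
    (Matrix.nonneg_iff_posSemidef.2 hΦ.posSemidef)
  let f : (ι → ℝ) →ₗ[ℝ] EuclideanSpace ℝ ι :=
    (WithLp.linearEquiv 2 ℝ (ι → ℝ)).symm.toLinearMap ∘ₗ B.mulVecLin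
  have hf : ∀ u v, inner ℝ (f u) (f v) = u ⬝ᵥ Φ *ᵥ v := fun u v => by
    rw [hB, ← Matrix.mulVec_mulVec, Matrix.dotProduct_mulVec, Matrix.star_eq_conjTranspose,
      Matrix.conjTranspose_eq_transpose_of_trivial, Matrix.vecMul_transpose]
    simp [f, EuclideanSpace.inner_eq_star_dotProduct, dotProduct_comm]
  have hinj : Function.Injective f := by
    refine (injective_iff_map_eq_zero f).2 fun u hu => ?_
    by_contra hne
    have h1 := hΦ.dotProduct_mulVec_pos hne
    have h2 := hf u u
    rw [hu] at h2
    simp only [star_trivial, inner_zero_left] at h1 h2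
    linarith
  refine ⟨(LinearEquiv.ofInjectiveOfFinrankEq f hinj (by simp)).toContinuousLinearEquiv,
    fun u v => ?_⟩
  exact hf u v

/-- A monotone relation between points and images. -/
def IsMonotoneRel {ι : Type*} [Fintype ι] (A : (ι → ℝ) → (ι → ℝ) → Prop) : Prop :=
  ∀ u g v h, A u g → A v h → 0 ≤ (u - v) ⬝ᵥ (g - h)

section Splitting

variable {ι : Type*} [Fintype ι] {H : Type*} [NormedAddCommGroup H]
  [InnerProductSpace ℝ H] {Φ : Matrix ι ι ℝ} {e : (ι → ℝ) ≃L[ℝ] H}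
  {A : (ι → ℝ) → (ι → ℝ) → Prop}

/-- With d = u - u' and D = z - z', monotonicity says ‖d‖² ≤ ⟨d, D⟩ in the Φ metric, so ‖2d - D‖² =
‖D‖² + 4(‖d‖² - ⟨d, D⟩) ≤ ‖D‖². -/
theorem IsMonotoneRel.norm_reflect_sub_le (hA : IsMonotoneRel A)
    (he : ∀ u v, inner ℝ (e u) (e v) = u ⬝ᵥ Φ *ᵥ v) {z z' u u' : ι → ℝ} (hu : A u (Φ *ᵥ (z - u)))
    (hu' : A u' (Φ *ᵥ (z' - u'))) :
    ‖e ((2 : ℝ) • u - z - ((2 : ℝ) • u' - z'))‖ ≤ ‖e (z - z')‖ := by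
  have h1 := hA _ _ _ _ hu hu'
  rw [← Matrix.mulVec_sub, ← he] at h1
  have h2 : z - u - (z' - u') = (z - z') - (u - u') := by abel
  have h3 : (2 : ℝ) • u - z - ((2 : ℝ) • u' - z') = (2 : ℝ) • (u - u') - (z - z') := by module
  rw [h2, map_sub e (z - z')] at h1
  rw [h3, map_sub, map_smul]
  refine (sq_le_sq₀ (norm_nonneg _) (norm_nonneg _)).1 ?_
  rw [norm_sub_sq_real, norm_smul, real_inner_smul_left]
  rw [inner_sub_right, real_inner_self_eq_norm_sq] at h1
  rw [Real.norm_ofNat]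
  nlinarith

/-- The resolvent is the average of the identity and its reflection. For z = z' this also gives
uniqueness of resolvent values. -/
theorem IsMonotoneRel.norm_resolvent_sub_le (hA : IsMonotoneRel A)
    (he : ∀ u v, inner ℝ (e u) (e v) = u ⬝ᵥ Φ *ᵥ v) {z z' u u' : ι → ℝ} (hu : A u (Φ *ᵥ (z - u)))
    (hu' : A u' (Φ *ᵥ (z' - u'))) : ‖e (u - u')‖ ≤ ‖e (z - z')‖ := by
  have h1 := hA.norm_reflect_sub_le he hu hu'
  have h3 : (2 : ℝ) • e (u - u') =
      e ((2 : ℝ) • u - z - ((2 : ℝ) • u' - z')) + e (z - z') := by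
    rw [← map_add, ← map_smul]
    congr 1
    module
  have h4 := norm_add_le (e ((2 : ℝ) • u - z - ((2 : ℝ) • u' - z'))) (e (z - z'))
  rw [← h3, norm_smul, Real.norm_ofNat] at h4
  linarith

end Splitting

/-- Convergence of the relaxed Peaceman-Rachford iteration for the sum of two monotone relations
with full-domain resolvents and a zero. -/
theorem tendsto_relaxed_splitting {ι : Type*} [Fintype ι] [DecidableEq ι] {Φ : Matrix ι ι ℝ}
    (hΦ : Φ.PosDef) {A B : (ι → ℝ) → (ι → ℝ) → Prop} (hA : IsMonotoneRel A)
    (hB : IsMonotoneRel B) (hAt : ∀ z, ∃ u, A u (Φ *ᵥ (z - u)))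
    (hBt : ∀ z, ∃ u, B u (Φ *ᵥ (z - u))) (hzero : ∃ u g, A u g ∧ B u (-g))
    {γ : ℕ → ℝ} (hγ : ∀ k, γ k ∈ Set.Icc (0 : ℝ) 1)
    (hγsum : Tendsto (fun m => ∑ k ∈ Finset.range m, γ k * (1 - γ k)) atTop atTop)
    {z u v : ℕ → ι → ℝ} (hu : ∀ k, A (u k) (Φ *ᵥ (z k - u k)))
    (hv : ∀ k, B (v k) (Φ *ᵥ ((2 : ℝ) • u k - z k - v k)))
    (hz : ∀ k, z (k + 1) = z k + (2 * γ k) • (v k - u k)) :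
    ∃ p g, A p g ∧ B p (-g) ∧ Tendsto u atTop (𝓝 p) := by
  obtain ⟨e, he⟩ := hΦ.exists_equiv_euclideanSpace
  choose a ha using hAt
  choose b hb using hBt
  have eq_of_le : ∀ {p q r : ι → ℝ}, ‖e (p - q)‖ ≤ ‖e (r - r)‖ → p = q := fun {p q r} h => by
    rw [sub_self, map_zero, norm_zero, norm_le_zero_iff] at h
    exact sub_eq_zero.1 ((map_eq_zero_iff e e.injective).1 h)
  have ha_uniq : ∀ z u, A u (Φ *ᵥ (z - u)) → u = a z := fun z u h =>
    eq_of_le (hA.norm_resolvent_sub_le he h (ha z))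
  have hb_uniq : ∀ z u, B u (Φ *ᵥ (z - u)) → u = b z := fun z u h =>
    eq_of_le (hB.norm_resolvent_sub_le he h (hb z))
  -- This equals (2b - id) ∘ (2a - id).
  let R : (ι → ℝ) → (ι → ℝ) := fun z => z + (2 : ℝ) • (b ((2 : ℝ) • a z - z) - a z)
  have hR : ∀ z z', ‖e (R z - R z')‖ ≤ ‖e (z - z')‖ := fun z z' => by
    have h1 := hB.norm_reflect_sub_le he (hb ((2 : ℝ) • a z - z)) (hb ((2 : ℝ) • a z' - z'))
    refine le_trans (le_of_eq ?_) (h1.trans (hA.norm_reflect_sub_le he (ha z) (ha z')))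
    congr 2
    simp only [R]
    module
  have hfix : ∃ p, R p = p := by
    obtain ⟨p, g, hg, hg'⟩ := hzero
    have hunit : IsUnit Φ.det := hΦ.isUnit.map Matrix.detMonoidHom
    have hinv : ∀ w, Φ *ᵥ (Φ⁻¹ *ᵥ w) = w := fun w => by
      rw [Matrix.mulVec_mulVec, Matrix.mul_nonsing_inv _ hunit, Matrix.one_mulVec]
    -- The fixed point is p + Φ⁻¹g: the first resolvent maps it to p, its reflection is p - Φ⁻¹g,
    -- and the second resolvent maps that to p again.
    have h1 : p = a (p + Φ⁻¹ *ᵥ g) := ha_uniq _ _ (by rwa [add_sub_cancel_left, hinv])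
    have h2 : p = b ((2 : ℝ) • p - (p + Φ⁻¹ *ᵥ g)) := hb_uniq _ _ (by
      have : (2 : ℝ) • p - (p + Φ⁻¹ *ᵥ g) - p = Φ⁻¹ *ᵥ (-g) := by
        rw [Matrix.mulVec_neg]
        module
      rwa [this, hinv])
    refine ⟨p + Φ⁻¹ *ᵥ g, ?_⟩
    simp only [R]
    rw [← h1, ← h2]
    simp
  obtain ⟨p, hp, hlim⟩ := tendsto_krasnoselskii_mann (R := fun x => e (R (e.symm x)))
    (z := fun k => e (z k))
    (fun x y => by simpa [← map_sub] using hR (e.symm x) (e.symm y))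
    (by obtain ⟨p, hp⟩ := hfix; exact ⟨e p, by simp [hp]⟩) hγ hγsum
    (fun k => by
      have h1 := ha_uniq _ _ (hu k)
      have h2 := hb_uniq _ _ (hv k)
      simp only [ContinuousLinearEquiv.symm_apply_apply, ← map_sub, ← map_smul, ← map_add]
      rw [hz k]
      congr 1
      simp only [R]
      rw [← h1, ← h2]
      module)
  set q := e.symm p with hq
  have hpq : p = e q := by simp [hq]
  have hRq : R q = q := e.injective (by rw [← hpq]; exact hp)
  -- At a fixed point both resolvents return a q, and their defining relations there carry opposite
  -- values ±Φ(q - a q).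
  have hbq : b ((2 : ℝ) • a q - q) = a q := by
    have : (2 : ℝ) • (b ((2 : ℝ) • a q - q) - a q) = 0 := by simpa [R] using hRq
    simpa [sub_eq_zero] using this
  refine ⟨a q, _, ha q, ?_, ?_⟩
  · have := hb ((2 : ℝ) • a q - q)
    rw [hbq] at this
    rw [← Matrix.mulVec_neg]
    convert this using 2
    module
  · have h1 : Tendsto (fun k => e (u k)) atTop (𝓝 (e (a q))) := by
      rw [tendsto_iff_norm_sub_tendsto_zero] at hlim ⊢
      refine squeeze_zero (fun _ => norm_nonneg _) (fun k => ?_) hlim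
      rw [hpq, ← map_sub, ← map_sub]
      exact hA.norm_resolvent_sub_le he (hu k) (ha q)
    have h2 := (e.symm.continuous.tendsto _).comp h1
    simpa [Function.comp_def] using h2

namespace Network

/-! ### Linear maps of the network in coordinates -/

variable {N l : ℕ} {n : Fin N → ℕ} {P : Network N l n}

theorem dotProduct_eq_parts (u v : P.State) :
    u ⬝ᵥ v = (∑ i, xPart u i ⬝ᵥ xPart v i) + (∑ i, sigPart u i ⬝ᵥ sigPart v i) +
      (∑ e, lamPart u e ⬝ᵥ lamPart v e) + (∑ i, yPart u i ⬝ᵥ yPart v i) +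
      (∑ e, muPart u e ⬝ᵥ muPart v e) + ∑ e, yEdgePart u e ⬝ᵥ yEdgePart v e := by
  simp only [dotProduct, Fintype.sum_sum_type, Fintype.sum_sigma, Fintype.sum_prod_type, xPart,
    sigPart, lamPart, yPart, muPart, yEdgePart]
  ring

theorem state_ext {u v : P.State} (hx : ∀ i, xPart u i = xPart v i)
    (hs : ∀ i, sigPart u i = sigPart v i) (hl : ∀ e, lamPart u e = lamPart v e)
    (hy : ∀ i, yPart u i = yPart v i) (hm : ∀ e, muPart u e = muPart v e)
    (hye : ∀ e, yEdgePart u e = yEdgePart v e) : u = v := by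
  funext q
  rcases q with (⟨i, a⟩ | ⟨i, a⟩) | ⟨e, a⟩ | ⟨i | e | e, a⟩
  · exact congrFun (hx i) a
  · exact congrFun (hs i) a
  · exact congrFun (hl e) a
  · exact congrFun (hy i) a
  · exact congrFun (hm e) a
  · exact congrFun (hye e) a

/-- The state with given parts. -/
def mkState (x : (i : Fin N) → Fin (n i) → ℝ) (s : Fin N → Fin l → ℝ) (lam : P.Edge → Fin l → ℝ)
    (y : Fin N → Fin l → ℝ) (mu ye : P.Edge → Fin l → ℝ) : P.State :=
  Sum.elim (Sum.elim (fun q => x q.1 q.2) fun q => s q.1 q.2)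
    (Sum.elim (fun q => lam q.1 q.2) fun q =>
      Sum.elim (fun i => y i q.2) (Sum.elim (fun e => mu e q.2) fun e => ye e q.2) q.1)

section mkState

variable (x : (i : Fin N) → Fin (n i) → ℝ) (s : Fin N → Fin l → ℝ) (lam : P.Edge → Fin l → ℝ)
  (y : Fin N → Fin l → ℝ) (mu ye : P.Edge → Fin l → ℝ)

@[simp] theorem xPart_mkState : xPart (mkState x s lam y mu ye) = x := rfl
@[simp] theorem sigPart_mkState : sigPart (mkState x s lam y mu ye) = s := rfl
@[simp] theorem lamPart_mkState : lamPart (mkState x s lam y mu ye) = lam := rfl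
@[simp] theorem yPart_mkState : yPart (mkState x s lam y mu ye) = y := rfl
@[simp] theorem muPart_mkState : muPart (mkState x s lam y mu ye) = mu := rfl
@[simp] theorem yEdgePart_mkState : yEdgePart (mkState x s lam y mu ye) = ye := rfl

end mkState

section Linear

variable (u v : P.State) (t : ℝ) (i : Fin N) (e : P.Edge)

@[simp] theorem xPart_add : xPart (u + v) i = xPart u i + xPart v i := rfl
@[simp] theorem xPart_sub : xPart (u - v) i = xPart u i - xPart v i := rfl
@[simp] theorem xPart_smul : xPart (t • u) i = t • xPart u i := rfl
@[simp] theorem sigPart_add : sigPart (u + v) i = sigPart u i + sigPart v i := rfl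
@[simp] theorem sigPart_sub : sigPart (u - v) i = sigPart u i - sigPart v i := rfl
@[simp] theorem sigPart_smul : sigPart (t • u) i = t • sigPart u i := rfl
@[simp] theorem lamPart_add : lamPart (u + v) e = lamPart u e + lamPart v e := rfl
@[simp] theorem lamPart_sub : lamPart (u - v) e = lamPart u e - lamPart v e := rfl
@[simp] theorem lamPart_smul : lamPart (t • u) e = t • lamPart u e := rfl
@[simp] theorem yPart_add : yPart (u + v) i = yPart u i + yPart v i := rfl
@[simp] theorem yPart_sub : yPart (u - v) i = yPart u i - yPart v i := rfl
@[simp] theorem yPart_smul : yPart (t • u) i = t • yPart u i := rfl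
@[simp] theorem muPart_add : muPart (u + v) e = muPart u e + muPart v e := rfl
@[simp] theorem muPart_sub : muPart (u - v) e = muPart u e - muPart v e := rfl
@[simp] theorem muPart_smul : muPart (t • u) e = t • muPart u e := rfl
@[simp] theorem yEdgePart_add : yEdgePart (u + v) e = yEdgePart u e + yEdgePart v e := rfl
@[simp] theorem yEdgePart_sub : yEdgePart (u - v) e = yEdgePart u e - yEdgePart v e := rfl
@[simp] theorem yEdgePart_smul : yEdgePart (t • u) e = t • yEdgePart u e := rfl

theorem lamB_apply (a : Fin l) : lamB u i a =
    ∑ e : P.Edge, ((if e.1.2 = i then 1 else 0) - (if e.1.1 = i then 1 else 0)) *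
      lamPart u e a := by
  simp only [lamB, Pi.sub_apply, Finset.sum_apply, ite_apply, Pi.zero_apply, sub_mul, ite_mul,
    one_mul, zero_mul, Finset.sum_sub_distrib]

theorem lamB_sub : lamB (u - v) i = lamB u i - lamB v i := by
  ext a
  simp [lamB_apply, mul_sub, Finset.sum_sub_distrib]

theorem disagreement_sub : disagreement (u - v) e = disagreement u e - disagreement v e := by
  simp only [disagreement, xPart_sub, sigPart_sub, Matrix.mulVec_sub]
  abel

end Linear

theorem Bl_mulVec (w : P.Edge × Fin l → ℝ) (i : Fin N) (a : Fin l) :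
    (P.Bl *ᵥ w) (i, a) =
      ∑ e : P.Edge, ((if e.1.2 = i then 1 else 0) - (if e.1.1 = i then 1 else 0)) * w (e, a) := by
  simp [Bl, Matrix.mulVec, dotProduct, Fintype.sum_prod_type, incidence, Matrix.one_apply]

theorem Bl_transpose_mulVec (w : Fin N × Fin l → ℝ) (e : P.Edge) (a : Fin l) :
    (P.Blᵀ *ᵥ w) (e, a) = w (e.1.2, a) - w (e.1.1, a) := by
  simp [Bl, Matrix.mulVec, dotProduct, Fintype.sum_prod_type, incidence, Matrix.one_apply,
    sub_mul, Finset.sum_sub_distrib]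

theorem bigA_mulVec (w : (Σ i : Fin N, Fin (n i)) → ℝ) (i : Fin N) (a : Fin l) :
    (P.bigA *ᵥ w) (i, a) = (P.A i *ᵥ fun b => w ⟨i, b⟩) a := by
  simp only [Matrix.mulVec, dotProduct, Fintype.sum_sigma, bigA, Matrix.of_apply, ite_mul,
    zero_mul]
  rw [Finset.sum_eq_single i]
  · simp
  · intro j _ hj
    simp [hj.symm]
  · simp

theorem bigA_transpose_mulVec (w : Fin N × Fin l → ℝ) (i : Fin N) (b : Fin (n i)) :
    (P.bigAᵀ *ᵥ w) ⟨i, b⟩ = ((P.A i)ᵀ *ᵥ fun a => w (i, a)) b := by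
  simp only [Matrix.mulVec, dotProduct, Fintype.sum_prod_type, bigA, Matrix.of_apply,
    Matrix.transpose_apply, ite_mul, zero_mul]
  rw [Finset.sum_eq_single i]
  · simp
  · intro j _ hj
    simp [hj]
  · simp

variable (P) in
/-- The part of `linT` that couples `x` and `σ` with `λ`. -/
def linLam : Matrix P.Idx P.Idx ℝ :=
  Matrix.fromBlocks
    0 (Matrix.fromBlocks (P.bigAᵀ * P.Bl) 0 P.Bl 0)
    (Matrix.fromBlocks (-(P.Blᵀ * P.bigA)) (-P.Blᵀ) 0 0) 0

variable (P) in
/-- The part of `linT` that acts on `ω`. -/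
def linOmega : Matrix P.Idx P.Idx ℝ :=
  Matrix.fromBlocks 0 0 0 (Matrix.fromBlocks 0 0 0 (P.My ⊗ₖ (1 : Matrix (Fin l) (Fin l) ℝ)))

theorem linT_eq : P.linT = P.linLam + P.linOmega := by
  simp [linT, linLam, linOmega, Matrix.fromBlocks_add]

theorem linLam_transpose : P.linLamᵀ = -P.linLam := by
  simp [linLam, Matrix.fromBlocks_transpose, Matrix.fromBlocks_neg, Matrix.transpose_mul]

theorem My_transpose : P.Myᵀ = -P.My := by
  ext r s
  rcases r with i | e | e <;> rcases s with j | f | f <;>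
    simp [My, Matrix.of_apply, eq_comm, apply_ite]

theorem linOmega_transpose : P.linOmegaᵀ = -P.linOmega := by
  have : P.Myᵀ ⊗ₖ (1 : Matrix (Fin l) (Fin l) ℝ) = -(P.My ⊗ₖ 1) := by
    rw [My_transpose, ← neg_one_smul ℝ P.My, Matrix.smul_kronecker, neg_one_smul]
  simp [linOmega, Matrix.fromBlocks_transpose, Matrix.fromBlocks_neg,
    ← Matrix.kroneckerMap_transpose, this]

section linLam

variable (u : P.State) (i : Fin N) (e : P.Edge)

theorem xPart_linLam : xPart (P.linLam *ᵥ u) i = (P.A i)ᵀ *ᵥ lamB u i := by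
  ext b
  simp only [xPart, linLam, Matrix.fromBlocks_mulVec, Sum.elim_inl, Matrix.zero_mulVec, zero_add,
    add_zero, ← Matrix.mulVec_mulVec, bigA_transpose_mulVec, Bl_mulVec]
  congr 2
  ext a
  rw [lamB_apply]
  rfl

theorem sigPart_linLam : sigPart (P.linLam *ᵥ u) i = lamB u i := by
  ext a
  simp only [sigPart, linLam, Matrix.fromBlocks_mulVec, Sum.elim_inl, Sum.elim_inr,
    Matrix.zero_mulVec, zero_add, add_zero, Bl_mulVec, lamB_apply]
  rfl

theorem lamPart_linLam : lamPart (P.linLam *ᵥ u) e = -disagreement u e := by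
  ext a
  simp only [lamPart, linLam, Matrix.fromBlocks_mulVec, Sum.elim_inl, Sum.elim_inr,
    Matrix.zero_mulVec, add_zero, Matrix.neg_mulVec, ← Matrix.mulVec_mulVec, Pi.add_apply,
    Pi.neg_apply, Bl_transpose_mulVec, bigA_mulVec, disagreement, Pi.sub_apply]
  change -((P.A e.1.2 *ᵥ xPart u e.1.2) a - (P.A e.1.1 *ᵥ xPart u e.1.1) a) +
    -(sigPart u e.1.2 a - sigPart u e.1.1 a) = _
  ring

theorem yPart_linLam : yPart (P.linLam *ᵥ u) i = 0 := by
  ext a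
  simp [yPart, linLam, Matrix.fromBlocks_mulVec]

theorem muPart_linLam : muPart (P.linLam *ᵥ u) e = 0 := by
  ext a
  simp [muPart, linLam, Matrix.fromBlocks_mulVec]

theorem yEdgePart_linLam : yEdgePart (P.linLam *ᵥ u) e = 0 := by
  ext a
  simp [yEdgePart, linLam, Matrix.fromBlocks_mulVec]

theorem xPart_linOmega : xPart (P.linOmega *ᵥ u) i = 0 := by
  ext a
  simp [xPart, linOmega, Matrix.fromBlocks_mulVec]

theorem sigPart_linOmega : sigPart (P.linOmega *ᵥ u) i = 0 := by
  ext a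
  simp [sigPart, linOmega, Matrix.fromBlocks_mulVec]

theorem lamPart_linOmega : lamPart (P.linOmega *ᵥ u) e = 0 := by
  ext a
  simp [lamPart, linOmega, Matrix.fromBlocks_mulVec]

theorem yPart_linOmega :
    yPart (P.linOmega *ᵥ u) i = -∑ f : P.Edge, if f.1.1 = i then muPart u f else 0 := by
  ext a
  rw [Pi.neg_apply, Finset.sum_apply, ← Finset.sum_neg_distrib]
  simp only [ite_apply, Pi.zero_apply]
  simp [yPart, linOmega, Matrix.mulVec, dotProduct, Fintype.sum_prod_type, Fintype.sum_sum_type,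
    My, Matrix.one_apply, muPart]
  rw [← Finset.sum_neg_distrib]
  exact Finset.sum_congr rfl fun f _ => by split_ifs <;> simp

theorem muPart_linOmega :
    muPart (P.linOmega *ᵥ u) e = yPart u e.1.1 - yEdgePart u e := by
  ext a
  simp [yPart, linOmega, Matrix.mulVec, dotProduct,
    Fintype.sum_prod_type, Fintype.sum_sum_type, My, Matrix.one_apply,
    muPart, yEdgePart, sub_eq_add_neg]

theorem yEdgePart_linOmega : yEdgePart (P.linOmega *ᵥ u) e = muPart u e := by
  ext a
  simp [linOmega, Matrix.mulVec, dotProduct,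
    Fintype.sum_prod_type, Fintype.sum_sum_type, My, Matrix.one_apply,
    muPart, yEdgePart]

end linLam

section designMatrix

variable (τ : P.StepSizes) (u : P.State) (i : Fin N) (e : P.Edge)

theorem xPart_designMatrix : xPart (designMatrix τ *ᵥ u) i =
    (τ.t1 i)⁻¹ • xPart u i - (1 / 2 : ℝ) • ((P.A i)ᵀ *ᵥ lamB u i) := by
  rw [← xPart_linLam]
  ext b
  simp only [xPart, linLam, designMatrix, Matrix.fromBlocks_mulVec, Sum.elim_inl,
    Matrix.zero_mulVec, zero_add, add_zero, Matrix.neg_mulVec, Matrix.smul_mulVec, Pi.add_apply,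
    Matrix.mulVec_diagonal, Pi.neg_apply, Pi.smul_apply, Pi.sub_apply, smul_eq_mul,
    ← sub_eq_add_neg]
  rfl

theorem sigPart_designMatrix : sigPart (designMatrix τ *ᵥ u) i =
    (τ.t2 i)⁻¹ • sigPart u i - (1 / 2 : ℝ) • lamB u i := by
  rw [← sigPart_linLam]
  ext b
  simp only [sigPart, linLam, designMatrix, Matrix.fromBlocks_mulVec, Sum.elim_inl, Sum.elim_inr,
    Matrix.zero_mulVec, zero_add, add_zero, Matrix.neg_mulVec, Matrix.smul_mulVec, Pi.add_apply,
    Matrix.mulVec_diagonal, Pi.neg_apply, Pi.smul_apply, Pi.sub_apply, smul_eq_mul,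
    ← sub_eq_add_neg]
  rfl

theorem lamPart_designMatrix : lamPart (designMatrix τ *ᵥ u) e =
    (τ.t3 e)⁻¹ • lamPart u e - (1 / 2 : ℝ) • disagreement u e := by
  rw [← neg_neg (disagreement u e), ← lamPart_linLam]
  ext b
  simp only [lamPart, linLam, designMatrix, Matrix.fromBlocks_mulVec, Sum.elim_inl, Sum.elim_inr,
    Matrix.zero_mulVec, zero_add, add_zero, Matrix.neg_mulVec, Matrix.smul_mulVec, Pi.add_apply,
    Matrix.mulVec_diagonal, Pi.neg_apply, Pi.smul_apply, Pi.sub_apply, smul_eq_mul,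
    Function.comp_apply]
  ring

theorem yPart_designMatrix : yPart (designMatrix τ *ᵥ u) i = (τ.t4 i)⁻¹ • yPart u i := by
  ext a
  simp [yPart, designMatrix, Matrix.fromBlocks_mulVec, Matrix.mulVec_diagonal, omegaOwner]

theorem muPart_designMatrix : muPart (designMatrix τ *ᵥ u) e = (τ.t4 e.1.1)⁻¹ • muPart u e := by
  ext a
  simp [muPart, designMatrix, Matrix.fromBlocks_mulVec, Matrix.mulVec_diagonal, omegaOwner]

theorem yEdgePart_designMatrix :
    yEdgePart (designMatrix τ *ᵥ u) e = (τ.t4 e.1.1)⁻¹ • yEdgePart u e := by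
  ext a
  simp [yEdgePart, designMatrix, Matrix.fromBlocks_mulVec, Matrix.mulVec_diagonal, omegaOwner]

end designMatrix

end Network

/-! ### Weighted sums of squared distances -/

section Quadratic

variable {E : Type*} [AddCommGroup E] [Module ℝ E]

theorem IsQuadratic.of_linear (φ : E →ₗ[ℝ] ℝ) :
    IsQuadratic (fun z => φ z) (fun _ => φ) (fun _ => 0) :=
  ⟨fun z d => by simp, fun t d => by simp⟩

theorem IsQuadratic.sqNorm_comp {ι : Type*} [Fintype ι] (L : E →ₗ[ℝ] (ι → ℝ)) (c : ℝ)
    (v : ι → ℝ) :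
    IsQuadratic (fun z => c * sqNorm (L z - v))
      (fun z => (2 * c) • (dotProductBilin ℝ ℝ (L z - v)).comp L) (fun d => c * sqNorm (L d)) := by
  refine ⟨fun z d => ?_, fun t d => ?_⟩
  · have : L (z + d) - v = (L z - v) + L d := by rw [map_add]; abel
    simp only [this, sqNorm, add_dotProduct, dotProduct_add, LinearMap.smul_apply,
      LinearMap.comp_apply, dotProductBilin_apply_apply, smul_eq_mul]
    rw [dotProduct_comm (L d) (L z - v)]
    ring
  · simp only [sqNorm, map_smul, smul_dotProduct, dotProduct_smul, smul_eq_mul]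
    ring

theorem IsQuadratic.add {h h' : E → ℝ} {grad grad' : E → E →ₗ[ℝ] ℝ} {q q' : E → ℝ}
    (hq : IsQuadratic h grad q) (hq' : IsQuadratic h' grad' q') :
    IsQuadratic (fun z => h z + h' z) (fun z => grad z + grad' z) (fun d => q d + q' d) :=
  ⟨fun z d => by rw [hq.expand, hq'.expand, LinearMap.add_apply]; ring,
    fun t d => by rw [hq.smul, hq'.smul]; ring⟩

theorem IsQuadratic.sum {κ : Type*} [Fintype κ] {h : κ → E → ℝ} {grad : κ → E → E →ₗ[ℝ] ℝ}
    {q : κ → E → ℝ} (hq : ∀ k, IsQuadratic (h k) (grad k) (q k)) :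
    IsQuadratic (fun z => ∑ k, h k z) (fun z => ∑ k, grad k z) (fun d => ∑ k, q k d) :=
  ⟨fun z d => by
    simp only [(hq _).expand, Finset.sum_add_distrib, LinearMap.sum_apply],
    fun t d => by simp only [(hq _).smul, Finset.mul_sum]⟩

end Quadratic

/-! ### Squared norms and skew-symmetric perturbations -/

theorem sqNorm_nonneg {ι : Type*} [Fintype ι] (v : ι → ℝ) : 0 ≤ sqNorm v :=
  Finset.sum_nonneg fun i _ => mul_self_nonneg (v i)

theorem norm_sq_le_sqNorm {ι : Type*} [Fintype ι] (v : ι → ℝ) : ‖v‖ ^ 2 ≤ sqNorm v := by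
  have h : ‖v‖ ≤ Real.sqrt (sqNorm v) := by
    refine (pi_norm_le_iff_of_nonneg (Real.sqrt_nonneg _)).2 fun i => ?_
    refine Real.le_sqrt_of_sq_le ?_
    rw [Real.norm_eq_abs, sq_abs, sq]
    exact Finset.single_le_sum (f := fun i => v i * v i) (fun j _ => mul_self_nonneg (v j))
      (Finset.mem_univ i)
  calc ‖v‖ ^ 2 ≤ Real.sqrt (sqNorm v) ^ 2 := by gcongr
    _ = sqNorm v := Real.sq_sqrt (sqNorm_nonneg v)

theorem continuous_sqNorm {ι : Type*} [Fintype ι] : Continuous (sqNorm : (ι → ℝ) → ℝ) := by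
  unfold sqNorm dotProduct
  fun_prop

theorem mulVec_dotProduct_of_skew {ι : Type*} [Fintype ι] {M : Matrix ι ι ℝ} (hM : Mᵀ = -M)
    (u v : ι → ℝ) : (M *ᵥ u) ⬝ᵥ v = -(u ⬝ᵥ M *ᵥ v) := by
  rw [Matrix.dotProduct_mulVec, ← Matrix.mulVec_transpose, hM, Matrix.neg_mulVec, neg_dotProduct,
    neg_neg]

theorem IsMonotoneRel.add_skew {ι : Type*} [Fintype ι] {A : (ι → ℝ) → (ι → ℝ) → Prop}
    (hA : IsMonotoneRel A) {M : Matrix ι ι ℝ} (hM : Mᵀ = -M) :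
    IsMonotoneRel fun u g => A u (g - M *ᵥ u) := by
  intro u g v h hg hh
  have h1 := hA _ _ _ _ hg hh
  have h2 : (u - v) ⬝ᵥ M *ᵥ (u - v) = 0 := by
    have := mulVec_dotProduct_of_skew hM (u - v) (u - v)
    rw [dotProduct_comm] at this
    linarith
  have h3 : g - M *ᵥ u - (h - M *ᵥ v) = (g - h) - M *ᵥ (u - v) := by
    rw [Matrix.mulVec_sub]
    abel
  rw [h3, dotProduct_sub, h2] at h1
  linarith

/-! ### Domains and affine minorants of closed convex proper functions -/

namespace IsCCP

variable {E : Type*} [NormedAddCommGroup E] [NormedSpace ℝ E] {f : E → EReal}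

theorem exists_eq_coe (hf : IsCCP f) {z : E} (hz : f z < ⊤) : ∃ b : ℝ, f z = b :=
  ⟨(f z).toReal, (EReal.coe_toReal hz.ne (hf.ne_bot z)).symm⟩

theorem fst_image_epi (hf : IsCCP f) :
    Prod.fst '' {p : E × ℝ | f p.1 ≤ (p.2 : EReal)} = effDom f := by
  ext z
  constructor
  · rintro ⟨p, hp, rfl⟩
    exact lt_of_le_of_lt hp (EReal.coe_lt_top _)
  · intro hz
    obtain ⟨b, hb⟩ := hf.exists_eq_coe hz
    exact ⟨(z, b), hb.le, rfl⟩

/-- A subgradient at z: z trivially minimizes f over the one-point space z + ⊥, which contains a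
relatively interior point of the domain. -/
theorem exists_affine_minorant (hf : IsCCP f) {z : E} (hz : z ∈ intrinsicInterior ℝ (effDom f)) :
    ∃ (φ : E →ₗ[ℝ] ℝ) (b : ℝ), ∀ w (t : ℝ), f w ≤ t → φ w + b ≤ t := by
  obtain ⟨a, ha⟩ := hf.exists_eq_coe
    (show z ∈ effDom f from intrinsicInterior_subset hz)
  obtain ⟨φ, -, hφ⟩ := exists_linear_le_of_min _ hf.convex_epi ⊥ (z := z) (a := a) ha.le
    (fun w t hwt hw => by
      have : w = z := sub_eq_zero.1 ((Submodule.mem_bot ℝ).1 hw)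
      subst this
      have h : f w ≤ t := hwt
      rw [ha] at h
      exact_mod_cast h)
    (b := z) (by simp) (by
      rw [hf.fst_image_epi]
      exact Prolongable.of_mem_intrinsicInterior hz)
  refine ⟨φ, a - φ z, fun w t hwt => ?_⟩
  have := hφ w t hwt
  rw [map_sub] at this
  linarith

end IsCCP

namespace Network

variable {N l : ℕ} {n : Fin N → ℕ} {P : Network N l n}

/-! ### The two monotone relations of the splitting -/

variable (P) in
/-- The states that satisfy all local constraints. -/
def localStates : Set P.State := {ψ | ∀ i, localPart ψ i ∈ P.localFeasB i}

variable (P) in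
/-- `g` is a subgradient at `ψ` of the sum of the objectives. -/
def relJ (ψ g : P.State) : Prop :=
  ∃ b : Fin N → ℝ, (∀ i, P.J i (xPart ψ i, sigPart ψ i) = b i) ∧
    ∀ (w : P.State) (a : Fin N → ℝ), (∀ i, P.J i (xPart w i, sigPart w i) ≤ a i) →
      ∑ i, b i + g ⬝ᵥ (w - ψ) ≤ ∑ i, a i

variable (P) in
/-- `g` is a normal vector at `ψ` to the local constraints. -/
def relS (ψ g : P.State) : Prop :=
  ψ ∈ P.localStates ∧ ∀ w ∈ P.localStates, g ⬝ᵥ (w - ψ) ≤ 0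

variable (P) in
/-- The skew-symmetric part of the first operator of the splitting. -/
def skewA : Matrix P.Idx P.Idx ℝ := (1 / 2 : ℝ) • P.linLam + P.linOmega

variable (P) in
/-- The skew-symmetric part of the second operator of the splitting. -/
def skewB : Matrix P.Idx P.Idx ℝ := (1 / 2 : ℝ) • P.linLam

variable (P) in
/-- The first operator of the splitting. -/
def relA (ψ g : P.State) : Prop := P.relJ ψ (g - P.skewA *ᵥ ψ)

variable (P) in
/-- The second operator of the splitting. -/
def relB (ψ g : P.State) : Prop := P.relS ψ (g - P.skewB *ᵥ ψ)

theorem linT_transpose : P.linTᵀ = -P.linT := by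
  rw [linT_eq, Matrix.transpose_add, linLam_transpose, linOmega_transpose, neg_add]

theorem skewA_add_skewB : P.skewA + P.skewB = P.linT := by
  rw [linT_eq, skewA, skewB]
  module

theorem isMonotoneRel_relA : IsMonotoneRel P.relA := by
  refine IsMonotoneRel.add_skew ?_ (by
    rw [skewA, Matrix.transpose_add, Matrix.transpose_smul, linLam_transpose, linOmega_transpose,
      smul_neg, neg_add])
  rintro u g v h ⟨b, hb, hg⟩ ⟨b', hb', hh⟩
  have h1 := hg v b' fun i => (hb' i).le
  have h2 := hh u b fun i => (hb i).le
  simp only [dotProduct_sub, sub_dotProduct] at h1 h2 ⊢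
  rw [dotProduct_comm u g, dotProduct_comm v g, dotProduct_comm u h, dotProduct_comm v h]
  linarith

theorem isMonotoneRel_relB : IsMonotoneRel P.relB := by
  refine IsMonotoneRel.add_skew ?_ (by
    rw [skewB, Matrix.transpose_smul, linLam_transpose, smul_neg])
  rintro u g v h ⟨hu, hg⟩ ⟨hv, hh⟩
  have h1 := hg v hv
  have h2 := hh u hu
  simp only [dotProduct_sub, sub_dotProduct] at h1 h2 ⊢
  rw [dotProduct_comm u g, dotProduct_comm v g, dotProduct_comm u h, dotProduct_comm v h]
  linarith

/-! ### The first resolvent -/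

/-- The updates that produce `ψ` from `ψt`. -/
structure FirstStep (τ : P.StepSizes) (ψt ψ : P.State) : Prop where
  acu : AuxConsensusUpdate τ ψt ψ
  argminA : ∀ i, IsMinOn (localObjA τ ψt i) Set.univ (xPart ψ i, sigPart ψ i)
  lam : ∀ e : P.Edge, lamPart ψ e =
    lamPart ψt e + ((1 / 2) * τ.t3 e) • disagreement ((2 : ℝ) • ψ - ψt) e

/-- The smooth part of the first local objective. -/
def smoothA (τ : P.StepSizes) (ψt : P.State) (i : Fin N)
    (z : (Fin (n i) → ℝ) × (Fin l → ℝ)) : ℝ :=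
  (1 / 2) * (lamB ψt i ⬝ᵥ (P.A i *ᵥ z.1 + z.2)) +
    1 / (2 * τ.t1 i) * sqNorm (z.1 - xPart ψt i) +
    1 / (2 * τ.t2 i) * sqNorm (z.2 - sigPart ψt i)

/-- The differential of `smoothA`. -/
def gradA (τ : P.StepSizes) (ψt : P.State) (i : Fin N)
    (z : (Fin (n i) → ℝ) × (Fin l → ℝ)) : (Fin (n i) → ℝ) × (Fin l → ℝ) →ₗ[ℝ] ℝ :=
  (1 / 2 : ℝ) • (dotProductBilin ℝ ℝ (lamB ψt i)).comp
      ((P.A i).mulVecLin.comp (LinearMap.fst ℝ _ _) + LinearMap.snd ℝ _ _) +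
    (2 * (1 / (2 * τ.t1 i))) •
      (dotProductBilin ℝ ℝ (z.1 - xPart ψt i)).comp (LinearMap.fst ℝ _ _) +
    (2 * (1 / (2 * τ.t2 i))) •
      (dotProductBilin ℝ ℝ (z.2 - sigPart ψt i)).comp (LinearMap.snd ℝ _ _)

theorem isQuadratic_smoothA (τ : P.StepSizes) (ψt : P.State) (i : Fin N) :
    IsQuadratic (smoothA τ ψt i) (gradA τ ψt i)
      (fun d => 0 + 1 / (2 * τ.t1 i) * sqNorm d.1 + 1 / (2 * τ.t2 i) * sqNorm d.2) :=
  ((IsQuadratic.of_linear ((1 / 2 : ℝ) • (dotProductBilin ℝ ℝ (lamB ψt i)).comp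
    ((P.A i).mulVecLin.comp (LinearMap.fst ℝ (Fin (n i) → ℝ) (Fin l → ℝ)) +
      LinearMap.snd ℝ (Fin (n i) → ℝ) (Fin l → ℝ)))).add
    (.sqNorm_comp (LinearMap.fst ℝ (Fin (n i) → ℝ) (Fin l → ℝ)) (1 / (2 * τ.t1 i))
      (xPart ψt i))).add
    (.sqNorm_comp (LinearMap.snd ℝ (Fin (n i) → ℝ) (Fin l → ℝ)) (1 / (2 * τ.t2 i))
      (sigPart ψt i))

theorem exists_argminA (hJ : ∀ i, IsCCP (P.J i)) (hX : P.FeasibleSetsRegular) (τ : P.StepSizes)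
    (ψt : P.State) (i : Fin N) : ∃ z, IsMinOn (localObjA τ ψt i) Set.univ z := by
  obtain ⟨xb, hxb⟩ := hX.slater
  obtain ⟨φ, b, hφ⟩ := (hJ i).exists_affine_minorant (hxb.mem_ri_dom i)
  have h1 := τ.t1_pos i
  have h2 := τ.t2_pos i
  obtain ⟨z, a, hza, hmin⟩ := (isQuadratic_smoothA τ ψt i).exists_min
    (κ := min (1 / (2 * τ.t1 i)) (1 / (2 * τ.t2 i)))
    (by
      have := continuous_sqNorm (ι := Fin (n i))
      have := continuous_sqNorm (ι := Fin l)
      unfold smoothA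
      fun_prop)
    (by positivity)
    (fun d => by
      have k1 := norm_sq_le_sqNorm d.1
      have k2 := norm_sq_le_sqNorm d.2
      have m1 := min_le_left (1 / (2 * τ.t1 i)) (1 / (2 * τ.t2 i))
      have m2 := min_le_right (1 / (2 * τ.t1 i)) (1 / (2 * τ.t2 i))
      have m0 : 0 < min (1 / (2 * τ.t1 i)) (1 / (2 * τ.t2 i)) := by positivity
      have n1 := sqNorm_nonneg d.1
      have n2 := sqNorm_nonneg d.2
      rw [Prod.norm_def, zero_add]
      rcases max_choice ‖d.1‖ ‖d.2‖ with h | h <;> rw [h]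
      · have := mul_le_mul m1 k1 (by positivity) (by positivity)
        have : 0 ≤ 1 / (2 * τ.t2 i) * sqNorm d.2 := by positivity
        linarith
      · have := mul_le_mul m2 k2 (by positivity) (by positivity)
        have : 0 ≤ 1 / (2 * τ.t1 i) * sqNorm d.1 := by positivity
        linarith)
    (hJ i).closed_epi
    (by
      obtain ⟨z, hz⟩ := (hJ i).proper
      obtain ⟨c, hc⟩ := (hJ i).exists_eq_coe (lt_top_iff_ne_top.2 hz)
      exact ⟨(z, c), hc.le⟩)
    (φ := φ) (b := b) (fun w t hwt => hφ w t hwt)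
  refine ⟨z, fun w _ => ?_⟩
  change P.J i z + (smoothA τ ψt i z : EReal) ≤ P.J i w + (smoothA τ ψt i w : EReal)
  by_cases hw : P.J i w = ⊤
  · rw [hw, EReal.top_add_coe]
    exact le_top
  obtain ⟨t, ht⟩ := (hJ i).exists_eq_coe (lt_top_iff_ne_top.2 hw)
  have := hmin w t ht.le
  calc P.J i z + (smoothA τ ψt i z : EReal) ≤ (a : EReal) + (smoothA τ ψt i z : EReal) :=
        add_le_add_left hza _
    _ = ((a + smoothA τ ψt i z : ℝ) : EReal) := by norm_cast
    _ ≤ ((t + smoothA τ ψt i w : ℝ) : EReal) := by exact_mod_cast this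
    _ = P.J i w + (smoothA τ ψt i w : EReal) := by rw [ht]; norm_cast

theorem argminA_variational (hJ : ∀ i, IsCCP (P.J i)) {τ : P.StepSizes} {ψt : P.State}
    {i : Fin N} {z : (Fin (n i) → ℝ) × (Fin l → ℝ)}
    (hz : IsMinOn (localObjA τ ψt i) Set.univ z) :
    ∃ b : ℝ, P.J i z = b ∧ ∀ w (t : ℝ), P.J i w ≤ t → b ≤ t + gradA τ ψt i z (w - z) := by
  have hmin : ∀ w, P.J i z + (smoothA τ ψt i z : EReal) ≤ P.J i w + (smoothA τ ψt i w : EReal) :=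
    fun w => hz (Set.mem_univ w)
  have hfin : P.J i z < ⊤ := by
    obtain ⟨w, hw⟩ := (hJ i).proper
    obtain ⟨t, ht⟩ := (hJ i).exists_eq_coe (lt_top_iff_ne_top.2 hw)
    by_contra hcon
    have h1 := hmin w
    rw [not_lt_top_iff.1 hcon, EReal.top_add_coe, ht, ← EReal.coe_add] at h1
    exact absurd h1 (not_le.2 (EReal.coe_lt_top _))
  obtain ⟨b, hb⟩ := (hJ i).exists_eq_coe hfin
  refine ⟨b, hb, fun w t hwt => ?_⟩
  refine (isQuadratic_smoothA τ ψt i).variational_inequality (hJ i).convex_epi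
    (a := b) hb.le (fun w t hwt => ?_) hwt
  have h1 := (hmin w).trans (add_le_add_left (show P.J i w ≤ t from hwt) _)
  rw [hb] at h1
  exact_mod_cast h1

theorem exists_firstStep (hJ : ∀ i, IsCCP (P.J i)) (hX : P.FeasibleSetsRegular)
    (τ : P.StepSizes) (ψt : P.State) : ∃ ψ, FirstStep τ ψt ψ := by
  choose z hz using exists_argminA hJ hX τ ψt
  let y : Fin N → Fin l → ℝ := fun i =>
    ((1 + τ.t4 i ^ 2) /
        (1 + τ.t4 i ^ 2 * (1 + ((Finset.univ.filter fun e : P.Edge => e.1.1 = i).card : ℝ)))) •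
      (yPart ψt i + (τ.t4 i / (1 + τ.t4 i ^ 2)) •
        ∑ e : P.Edge, if e.1.1 = i then muPart ψt e + τ.t4 i • yEdgePart ψt e else 0)
  let mu : P.Edge → Fin l → ℝ := fun e => (1 / (1 + τ.t4 e.1.1 ^ 2)) • muPart ψt e +
      (τ.t4 e.1.1 / (1 + τ.t4 e.1.1 ^ 2)) • (yEdgePart ψt e - y e.1.1)
  let ye : P.Edge → Fin l → ℝ := fun e => yEdgePart ψt e - τ.t4 e.1.1 • mu e
  let ψ₀ : P.State := mkState (fun i => (z i).1) (fun i => (z i).2) 0 y mu ye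
  exact ⟨mkState (fun i => (z i).1) (fun i => (z i).2)
    (fun e => lamPart ψt e + ((1 / 2) * τ.t3 e) • disagreement ((2 : ℝ) • ψ₀ - ψt) e) y mu ye,
    ⟨fun _ => rfl, fun _ => rfl, fun _ => rfl⟩, hz, fun _ => rfl⟩

/-- The closed-form update solves the implicit resolvent system of `My`; this is its y-row, and the
μ- and y_{ij}-rows follow. -/
theorem AuxConsensusUpdate.y_eq {τ : P.StepSizes} {ψt ψ : P.State}
    (h : AuxConsensusUpdate τ ψt ψ) (i : Fin N) :
    (τ.t4 i)⁻¹ • (yPart ψt i - yPart ψ i) =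
      -∑ e : P.Edge, if e.1.1 = i then muPart ψ e else 0 := by
  ext a
  have ht := τ.t4_pos i
  have h1 := congrFun (h.y i) a
  -- The μ-updates of all out-edges of i share the same y_i, so their sum contains it with the
  -- out-degree as factor.
  have h2 : ∑ e : P.Edge, (if e.1.1 = i then muPart ψ e a else 0) =
      1 / (1 + τ.t4 i ^ 2) *
        ∑ e : P.Edge, (if e.1.1 = i then muPart ψt e a + τ.t4 i * yEdgePart ψt e a else 0) -
      τ.t4 i / (1 + τ.t4 i ^ 2) *
        (((Finset.univ.filter fun e : P.Edge => e.1.1 = i).card : ℝ) * yPart ψ i a) := by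
    rw [Finset.card_filter, Nat.cast_sum, Finset.sum_mul, Finset.mul_sum, Finset.mul_sum,
      ← Finset.sum_sub_distrib]
    refine Finset.sum_congr rfl fun e _ => ?_
    split_ifs with he
    · subst he
      have := congrFun (h.mu e) a
      simp only [Pi.add_apply, Pi.smul_apply, Pi.sub_apply, smul_eq_mul] at this
      rw [this]
      push_cast
      ring
    · simp
  simp only [Pi.add_apply, Pi.smul_apply, smul_eq_mul, Finset.sum_apply, ite_apply,
    Pi.zero_apply] at h1
  simp only [Pi.neg_apply, Pi.smul_apply, smul_eq_mul, Finset.sum_apply, ite_apply,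
    Pi.zero_apply, Pi.sub_apply]
  rw [h2]
  have hc : (0 : ℝ) ≤ ((Finset.univ.filter fun e : P.Edge => e.1.1 = i).card : ℝ) := by positivity
  generalize ((Finset.univ.filter fun e : P.Edge => e.1.1 = i).card : ℝ) = c at *
  generalize (∑ e : P.Edge, (if e.1.1 = i then muPart ψt e a + τ.t4 i * yEdgePart ψt e a
    else 0)) = S at *
  generalize yPart ψ i a = y at *
  have hd : 1 + τ.t4 i ^ 2 * (1 + c) ≠ 0 := by positivity
  field_simp at h1 ⊢
  linear_combination -h1

theorem AuxConsensusUpdate.mu_eq {τ : P.StepSizes} {ψt ψ : P.State}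
    (h : AuxConsensusUpdate τ ψt ψ) (e : P.Edge) :
    (τ.t4 e.1.1)⁻¹ • (muPart ψt e - muPart ψ e) = yPart ψ e.1.1 - yEdgePart ψ e := by
  ext a
  have ht := τ.t4_pos e.1.1
  have h1 := congrFun (h.mu e) a
  have h2 := congrFun (h.yEdge e) a
  simp only [Pi.add_apply, Pi.smul_apply, smul_eq_mul, Pi.sub_apply] at h1 h2 ⊢
  rw [h2]
  field_simp at h1 ⊢
  linear_combination -h1

theorem AuxConsensusUpdate.yEdge_eq {τ : P.StepSizes} {ψt ψ : P.State}
    (h : AuxConsensusUpdate τ ψt ψ) (e : P.Edge) :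
    (τ.t4 e.1.1)⁻¹ • (yEdgePart ψt e - yEdgePart ψ e) = muPart ψ e := by
  rw [h.yEdge e, sub_sub_cancel, smul_smul, inv_mul_cancel₀ (τ.t4_pos _).ne', one_smul]

/-- In the x and σ rows the half couplings of Φ and `skewA` cancel the new λ, leaving minus the
gradient of `smoothA`. In all other rows the explicit updates make the residual g zero, as they must
because J does not depend on those components. -/
theorem FirstStep.relA (hJ : ∀ i, IsCCP (P.J i)) {τ : P.StepSizes} {ψt ψ : P.State}
    (h : FirstStep τ ψt ψ) : P.relA ψ (designMatrix τ *ᵥ (ψt - ψ)) := by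
  choose b hb hvar using fun i => argminA_variational hJ (h.argminA i)
  refine ⟨b, hb, fun w a hw => ?_⟩
  set g := designMatrix τ *ᵥ (ψt - ψ) - P.skewA *ᵥ ψ with hg
  have gx : ∀ i, xPart g i = (τ.t1 i)⁻¹ • (xPart ψt i - xPart ψ i) -
      (1 / 2 : ℝ) • ((P.A i)ᵀ *ᵥ lamB ψt i) := fun i => by
    rw [hg, skewA, Matrix.add_mulVec, Matrix.smul_mulVec, xPart_sub, xPart_designMatrix, xPart_add,
      xPart_smul, xPart_linLam, xPart_linOmega, lamB_sub, xPart_sub, Matrix.mulVec_sub]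
    module
  have gs : ∀ i, sigPart g i = (τ.t2 i)⁻¹ • (sigPart ψt i - sigPart ψ i) -
      (1 / 2 : ℝ) • lamB ψt i := fun i => by
    rw [hg, skewA, Matrix.add_mulVec, Matrix.smul_mulVec, sigPart_sub, sigPart_designMatrix,
      sigPart_add, sigPart_smul, sigPart_linLam, sigPart_linOmega, lamB_sub, sigPart_sub]
    module
  have gl : ∀ e, lamPart g e = 0 := fun e => by
    have h1 := h.lam e
    have h2 : disagreement ((2 : ℝ) • ψ - ψt) e =
        disagreement ψ e - disagreement (ψt - ψ) e := by
      rw [← disagreement_sub]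
      congr 1
      module
    rw [hg, skewA, Matrix.add_mulVec, Matrix.smul_mulVec, lamPart_sub, lamPart_designMatrix,
      lamPart_add, lamPart_smul, lamPart_linLam, lamPart_linOmega, lamPart_sub]
    have h3 : lamPart ψt e - lamPart ψ e = -(((1 / 2) * τ.t3 e) •
        (disagreement ψ e - disagreement (ψt - ψ) e)) := by rw [h1, h2]; abel
    rw [h3, smul_neg, smul_smul]
    have h4 : (τ.t3 e)⁻¹ * (1 / 2 * τ.t3 e) = 1 / 2 := by
      have := (τ.t3_pos e).ne'
      field_simp
    rw [h4]
    module
  have gy : ∀ i, yPart g i = 0 := fun i => by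
    rw [hg, skewA, Matrix.add_mulVec, Matrix.smul_mulVec, yPart_sub, yPart_designMatrix,
      yPart_add, yPart_smul, yPart_linLam, yPart_linOmega, yPart_sub, h.acu.y_eq]
    simp
  have gm : ∀ e, muPart g e = 0 := fun e => by
    rw [hg, skewA, Matrix.add_mulVec, Matrix.smul_mulVec, muPart_sub, muPart_designMatrix,
      muPart_add, muPart_smul, muPart_linLam, muPart_linOmega, muPart_sub, h.acu.mu_eq]
    simp
  have gye : ∀ e, yEdgePart g e = 0 := fun e => by
    rw [hg, skewA, Matrix.add_mulVec, Matrix.smul_mulVec, yEdgePart_sub, yEdgePart_designMatrix,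
      yEdgePart_add, yEdgePart_smul, yEdgePart_linLam, yEdgePart_linOmega, yEdgePart_sub,
      h.acu.yEdge_eq]
    simp
  rw [dotProduct_eq_parts]
  simp only [gl, gy, gm, gye, zero_dotProduct, Finset.sum_const_zero, add_zero]
  rw [← Finset.sum_add_distrib, ← Finset.sum_add_distrib]
  refine Finset.sum_le_sum fun i _ => ?_
  have h1 := hvar i _ _ (hw i)
  have h2 : gradA τ ψt i (xPart ψ i, sigPart ψ i)
      ((xPart w i, sigPart w i) - (xPart ψ i, sigPart ψ i)) =
      -(xPart g i ⬝ᵥ xPart (w - ψ) i + sigPart g i ⬝ᵥ sigPart (w - ψ) i) := by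
    rw [gx, gs]
    simp only [gradA, LinearMap.add_apply, LinearMap.smul_apply, LinearMap.comp_apply,
      dotProductBilin_apply_apply, LinearMap.fst_apply, LinearMap.snd_apply,
      Matrix.mulVecLin_apply, Prod.fst_sub, Prod.snd_sub, smul_eq_mul, xPart_sub, sigPart_sub,
      dotProduct_add, Matrix.dotProduct_mulVec, Matrix.mulVec_transpose, sub_dotProduct,
      smul_dotProduct]
    have := (τ.t1_pos i).ne'
    have := (τ.t2_pos i).ne'
    field_simp
    ring
  rw [h2] at h1
  linarith

end Network

/-! ### Product norms and the range of a transpose -/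

theorem Prod.norm_sq_le_add {E F : Type*} [SeminormedAddCommGroup E] [SeminormedAddCommGroup F]
    (p : E × F) : ‖p‖ ^ 2 ≤ ‖p.1‖ ^ 2 + ‖p.2‖ ^ 2 := by
  rw [Prod.norm_def]
  rcases max_choice ‖p.1‖ ‖p.2‖ with h | h <;> rw [h] <;>
    nlinarith [sq_nonneg ‖p.1‖, sq_nonneg ‖p.2‖]

theorem Pi.norm_sq_le_sum {κ : Type*} [Fintype κ] {E : κ → Type*}
    [∀ k, SeminormedAddCommGroup (E k)] (f : ∀ k, E k) : ‖f‖ ^ 2 ≤ ∑ k, ‖f k‖ ^ 2 := by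
  have h : ‖f‖ ≤ Real.sqrt (∑ k, ‖f k‖ ^ 2) := by
    refine (pi_norm_le_iff_of_nonneg (Real.sqrt_nonneg _)).2 fun i => ?_
    refine Real.le_sqrt_of_sq_le ?_
    exact Finset.single_le_sum (f := fun i => ‖f i‖ ^ 2) (fun j _ => sq_nonneg _)
      (Finset.mem_univ i)
  calc ‖f‖ ^ 2 ≤ Real.sqrt (∑ k, ‖f k‖ ^ 2) ^ 2 := by gcongr
    _ = _ := Real.sq_sqrt (Finset.sum_nonneg fun k _ => sq_nonneg _)

/-- The range of the transpose is the orthogonal complement of the kernel. -/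
theorem Matrix.exists_transpose_mulVec_eq {m n : Type*} [Fintype m] [Fintype n] [DecidableEq m]
    [DecidableEq n] {M : Matrix m n ℝ} {v : n → ℝ} (h : ∀ u, M *ᵥ u = 0 → v ⬝ᵥ u = 0) :
    ∃ y, Mᵀ *ᵥ y = v := by
  have h1 : dotProductBilin ℝ ℝ v ∈ (LinearMap.ker M.mulVecLin).dualAnnihilator := by
    rw [Submodule.mem_dualAnnihilator]
    intro u hu
    exact h u hu
  rw [← LinearMap.range_dualMap_eq_dualAnnihilator_ker] at h1
  obtain ⟨φ, hφ⟩ := h1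
  refine ⟨fun a => φ (Pi.single a 1), ?_⟩
  ext b
  have h2 := LinearMap.congr_fun hφ (Pi.single b 1)
  simp only [LinearMap.dualMap_apply, Matrix.mulVecLin_apply, Matrix.mulVec_single_one,
    dotProductBilin_apply_apply, dotProduct_single_one] at h2
  have hs : ∀ a : m, (fun j => if a = j then (1 : ℝ) else 0) = Pi.single a 1 := fun a => by
    ext j
    simp [Pi.single_apply, eq_comm]
  rw [← h2, LinearMap.pi_apply_eq_sum_univ φ]
  simp only [hs]
  rfl

namespace Network

variable {N l : ℕ} {n : Fin N → ℕ} {P : Network N l n}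

/-! ### The second resolvent -/

/-- The updates that produce `ψb` from `ψh`. -/
structure SecondStep (τ : P.StepSizes) (ψh ψb : P.State) : Prop where
  feasB : ∀ i, localPart ψb i ∈ P.localFeasB i
  argminB : ∀ i, IsMinOn (localObjB τ ψh i) (P.localFeasB i) (localPart ψb i)
  lamBar : ∀ e : P.Edge, lamPart ψb e =
    lamPart ψh e + τ.t3 e • (disagreement ψb e - (1 / 2 : ℝ) • disagreement ψh e)
  muBar : ∀ e : P.Edge, muPart ψb e = muPart ψh e

variable (P) in
def projX (i : Fin N) : P.Local i →ₗ[ℝ] (Fin (n i) → ℝ) := LinearMap.fst ℝ _ _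

variable (P) in
def projSig (i : Fin N) : P.Local i →ₗ[ℝ] (Fin l → ℝ) :=
  (LinearMap.fst ℝ _ _).comp (LinearMap.snd ℝ _ _)

variable (P) in
def projY (i : Fin N) : P.Local i →ₗ[ℝ] (Fin l → ℝ) :=
  (LinearMap.fst ℝ _ _).comp ((LinearMap.snd ℝ _ _).comp (LinearMap.snd ℝ _ _))

variable (P) in
def projYEdge (i : Fin N) (e : P.InEdge i) : P.Local i →ₗ[ℝ] (Fin l → ℝ) :=
  (LinearMap.proj e).comp
    ((LinearMap.snd ℝ _ _).comp ((LinearMap.snd ℝ _ _).comp (LinearMap.snd ℝ _ _)))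

/-- The differential of the second local objective. -/
def gradB (τ : P.StepSizes) (ψh : P.State) (i : Fin N) (z : P.Local i) : P.Local i →ₗ[ℝ] ℝ :=
  (2 * (1 / (2 * τ.t1 i))) • (dotProductBilin ℝ ℝ (P.projX i z -
      (xPart ψh i - (τ.t1 i / 2) • ((P.A i)ᵀ *ᵥ lamB ψh i)))).comp (P.projX i) +
    (2 * (1 / (2 * τ.t2 i))) • (dotProductBilin ℝ ℝ (P.projSig i z -
      (sigPart ψh i - (τ.t2 i / 2) • lamB ψh i))).comp (P.projSig i) +
    (2 * (1 / (2 * τ.t4 i))) • (dotProductBilin ℝ ℝ (P.projY i z - yPart ψh i)).comp (P.projY i) +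
    ∑ e : P.InEdge i, (2 * (1 / (2 * τ.t4 e.1.1.1))) •
      (dotProductBilin ℝ ℝ (P.projYEdge i e z - yEdgePart ψh e.1)).comp (P.projYEdge i e)

theorem isQuadratic_localObjB (τ : P.StepSizes) (ψh : P.State) (i : Fin N) :
    IsQuadratic (localObjB τ ψh i) (gradB τ ψh i)
      (fun d => 1 / (2 * τ.t1 i) * sqNorm (P.projX i d) + 1 / (2 * τ.t2 i) * sqNorm (P.projSig i d)
        + 1 / (2 * τ.t4 i) * sqNorm (P.projY i d) +
        ∑ e : P.InEdge i, 1 / (2 * τ.t4 e.1.1.1) * sqNorm (P.projYEdge i e d)) :=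
  (((IsQuadratic.sqNorm_comp (P.projX i) (1 / (2 * τ.t1 i)) _).add
    (.sqNorm_comp (P.projSig i) (1 / (2 * τ.t2 i)) _)).add
    (.sqNorm_comp (P.projY i) (1 / (2 * τ.t4 i)) (yPart ψh i))).add
    (.sum fun e : P.InEdge i => .sqNorm_comp (P.projYEdge i e) (1 / (2 * τ.t4 e.1.1.1))
      (yEdgePart ψh e.1))

theorem smul_add_smul_mem_setF {i : Fin N} {z w : P.Local i} (hz : z ∈ P.setF i)
    (hw : w ∈ P.setF i) (s t : ℝ) : s • z + t • w ∈ P.setF i := by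
  have h1 : _ = _ := hz
  have h2 : _ = _ := hw
  change _ = _
  have h3 := congrArg₂ (· + ·) (congrArg (s • ·) h1) (congrArg (t • ·) h2)
  simp only [Finset.smul_sum, smul_add] at h3
  simp only [Prod.fst_add, Prod.snd_add, Prod.smul_fst, Prod.smul_snd, Matrix.mulVec_add,
    Matrix.mulVec_smul, Pi.add_apply, Pi.smul_apply, smul_add, Finset.sum_add_distrib]
  simp only [smul_comm (P.W _ _) s, smul_comm (P.W _ _) t]
  rw [← sub_eq_zero] at h3 ⊢
  rw [← h3]
  module

theorem convex_setQ (i : Fin N) : Convex ℝ (P.setQ i) := by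
  intro z hz w hw s t hs ht hst
  have h1 : s • (P.A i *ᵥ z.1 + z.2) + t • (P.A i *ᵥ w.1 + w.2) ≤ s • P.c + t • P.c :=
    add_le_add (smul_le_smul_of_nonneg_left hz hs) (smul_le_smul_of_nonneg_left hw ht)
  rw [← add_smul, hst, one_smul] at h1
  refine le_trans (le_of_eq ?_) h1
  simp only [Prod.fst_add, Prod.snd_add, Prod.smul_fst, Prod.smul_snd, Matrix.mulVec_add,
    Matrix.mulVec_smul]
  module

theorem convex_localFeasB (hX : P.FeasibleSetsRegular) (i : Fin N) :
    Convex ℝ (P.localFeasB i) := by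
  rintro z ⟨hz, hzF, hzQ⟩ w ⟨hw, hwF, hwQ⟩ s t hs ht hst
  exact ⟨hX.convex i hz hw hs ht hst, smul_add_smul_mem_setF hzF hwF s t,
    convex_setQ i (show (z.1, z.2.1) ∈ P.setQ i from hzQ) (show (w.1, w.2.1) ∈ P.setQ i from hwQ)
      hs ht hst⟩

theorem isClosed_localFeasB (hX : P.FeasibleSetsRegular) (i : Fin N) :
    IsClosed (P.localFeasB i) := by
  refine ((hX.closed i).preimage continuous_fst).inter (IsClosed.inter ?_ ?_)
  · exact isClosed_eq
      (f := fun z : P.Local i => ((N : ℝ) - 1) • (P.A i *ᵥ z.1) - z.2.1)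
      (g := fun z => P.W i i • z.2.2.1 + ∑ e : P.InEdge i, P.W e.1.1.1 i • z.2.2.2 e)
      (by fun_prop) (by fun_prop)
  · exact isClosed_le (f := fun z : P.Local i => P.A i *ᵥ z.1 + z.2.1) (by fun_prop)
      continuous_const

theorem exists_argminB (hX : P.FeasibleSetsRegular) (τ : P.StepSizes) (ψh : P.State) (i : Fin N)
    (hne : (P.localFeasB i).Nonempty) :
    ∃ z ∈ P.localFeasB i, IsMinOn (localObjB τ ψh i) (P.localFeasB i) z := by
  have : Nonempty (Fin N) := ⟨i⟩
  -- The weight of y_{ji} involves the step size of the neighbour j, so the modulus κ is taken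
  -- uniform over all agents.
  obtain ⟨j, hj⟩ := Finite.exists_min fun j => 1 / (2 * τ.t4 j)
  have h1 := τ.t1_pos i
  have h2 := τ.t2_pos i
  have h4 := τ.t4_pos j
  set κ := min (1 / (2 * τ.t4 j)) (min (1 / (2 * τ.t1 i)) (1 / (2 * τ.t2 i))) with hκ
  have κpos : 0 < κ := by positivity
  have κ1 : κ ≤ 1 / (2 * τ.t1 i) := (min_le_right _ _).trans (min_le_left _ _)
  have κ2 : κ ≤ 1 / (2 * τ.t2 i) := (min_le_right _ _).trans (min_le_right _ _)
  have κ4 : ∀ k, κ ≤ 1 / (2 * τ.t4 k) := fun k => (min_le_left _ _).trans (hj k)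
  have hsq : ∀ {ι : Type} [Fintype ι] (v : ι → ℝ) {c : ℝ}, κ ≤ c → κ * ‖v‖ ^ 2 ≤ c * sqNorm v :=
    fun v c hc => mul_le_mul hc (norm_sq_le_sqNorm v) (by positivity) (κpos.le.trans hc)
  have hcont : Continuous (localObjB τ ψh i) := by
    have := continuous_sqNorm (ι := Fin (n i))
    have := continuous_sqNorm (ι := Fin l)
    unfold localObjB
    fun_prop
  -- The constraint set enters as C × {0}, so that minimization over a set is the case of vanishing
  -- last coordinate.
  obtain ⟨z, a, ⟨hz, rfl⟩, hmin⟩ := (isQuadratic_localObjB τ ψh i).exists_min hcont κpos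
    (fun d => by
      have k1 := Prod.norm_sq_le_add d
      have k2 := Prod.norm_sq_le_add d.2
      have k3 := Prod.norm_sq_le_add d.2.2
      have k4 := Pi.norm_sq_le_sum d.2.2.2
      have q1 := hsq (P.projX i d) κ1
      have q2 := hsq (P.projSig i d) κ2
      have q3 := hsq (P.projY i d) (κ4 i)
      have q4 : κ * ∑ e, ‖d.2.2.2 e‖ ^ 2 ≤
          ∑ e : P.InEdge i, 1 / (2 * τ.t4 e.1.1.1) * sqNorm (P.projYEdge i e d) := by
        rw [Finset.mul_sum]
        exact Finset.sum_le_sum fun e _ => hsq (P.projYEdge i e d) (κ4 _)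
      refine le_trans ?_ (add_le_add (add_le_add (add_le_add q1 q2) q3) q4)
      rw [← mul_add, ← mul_add, ← mul_add]
      refine mul_le_mul_of_nonneg_left ?_ κpos.le
      change _ ≤ ‖d.1‖ ^ 2 + ‖d.2.1‖ ^ 2 + ‖d.2.2.1‖ ^ 2 + _
      linarith)
    (C := P.localFeasB i ×ˢ {0}) ((isClosed_localFeasB hX i).prod isClosed_singleton)
    (hne.prod (Set.singleton_nonempty 0)) (φ := 0) (b := 0) (by
      rintro w t ⟨-, rfl⟩
      simp)
  refine ⟨z, hz, fun w hw => ?_⟩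
  simpa using hmin w 0 ⟨hw, rfl⟩

theorem argminB_variational (hX : P.FeasibleSetsRegular) {τ : P.StepSizes} {ψh : P.State}
    {i : Fin N} {z : P.Local i} (hz : z ∈ P.localFeasB i)
    (hmin : IsMinOn (localObjB τ ψh i) (P.localFeasB i) z) {w : P.Local i}
    (hw : w ∈ P.localFeasB i) : 0 ≤ gradB τ ψh i z (w - z) := by
  have := (isQuadratic_localObjB τ ψh i).variational_inequality
    (C := P.localFeasB i ×ˢ {0}) ((convex_localFeasB hX i).prod (convex_singleton 0))
    (z := z) (a := 0) ⟨hz, rfl⟩ (by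
      rintro w t ⟨hw, rfl⟩
      simpa using hmin hw) (w := w) (t := 0) ⟨hw, rfl⟩
  simpa using this

/-- Each y_{ji} is held by exactly one agent, the head of its edge, so local variables can be chosen
independently and glued. -/
theorem exists_localPart_eq (z : ∀ i, P.Local i) (lam mu : P.Edge → Fin l → ℝ) :
    ∃ ψ : P.State, (∀ i, localPart ψ i = z i) ∧ lamPart ψ = lam ∧ muPart ψ = mu := by
  refine ⟨mkState (fun i => (z i).1) (fun i => (z i).2.1) lam (fun i => (z i).2.2.1) mu
    (fun e => (z e.1.2).2.2.2 ⟨e, rfl⟩), fun i => ?_, rfl, rfl⟩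
  have : (fun e : P.InEdge i => (z e.1.1.2).2.2.2 ⟨e.1, rfl⟩) = (z i).2.2.2 := by
    funext ⟨e, he⟩
    subst he
    rfl
  simp only [localPart, xPart_mkState, sigPart_mkState, yPart_mkState, yEdgePart_mkState]
  rw [this]

theorem exists_secondStep (hX : P.FeasibleSetsRegular) (hne : ∀ i, (P.localFeasB i).Nonempty)
    (τ : P.StepSizes) (ψh : P.State) : ∃ ψb, SecondStep τ ψh ψb := by
  choose z hz hmin using fun i => exists_argminB hX τ ψh i (hne i)
  obtain ⟨ψ₀, h₀, -⟩ := exists_localPart_eq z 0 0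
  obtain ⟨ψ, hψ, hlam, hmu⟩ := exists_localPart_eq z
    (fun e => lamPart ψh e + τ.t3 e • (disagreement ψ₀ e - (1 / 2 : ℝ) • disagreement ψh e))
    (muPart ψh)
  have hx : ∀ i, xPart ψ i = xPart ψ₀ i := fun i => congrArg Prod.fst ((hψ i).trans (h₀ i).symm)
  have hs : ∀ i, sigPart ψ i = sigPart ψ₀ i :=
    fun i => congrArg (fun z => z.2.1) ((hψ i).trans (h₀ i).symm)
  refine ⟨ψ, fun i => hψ i ▸ hz i, fun i => by rw [hψ i]; exact hmin i, fun e => ?_,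
    fun e => by rw [hmu]⟩
  rw [hlam]
  simp only [disagreement, hx, hs]

theorem sum_inEdge {M : Type*} [AddCommMonoid M] (f : P.Edge → M) :
    ∑ i, ∑ e : P.InEdge i, f e.1 = ∑ e, f e :=
  Fintype.sum_fiberwise (fun e : P.Edge => e.1.2) f

/-- The same cancellation of λ as in the first resolvent; here the y and y_{ji} rows belong to the
local minimization, and only the λ and μ rows of g vanish. -/
theorem SecondStep.relB (hX : P.FeasibleSetsRegular) {τ : P.StepSizes} {ψh ψb : P.State}
    (h : SecondStep τ ψh ψb) : P.relB ψb (designMatrix τ *ᵥ (ψh - ψb)) := by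
  refine ⟨h.feasB, fun w hw => ?_⟩
  set g := designMatrix τ *ᵥ (ψh - ψb) - P.skewB *ᵥ ψb with hg
  have gx : ∀ i, xPart g i = (τ.t1 i)⁻¹ • (xPart ψh i - xPart ψb i) -
      (1 / 2 : ℝ) • ((P.A i)ᵀ *ᵥ lamB ψh i) := fun i => by
    rw [hg, skewB, Matrix.smul_mulVec, xPart_sub, xPart_designMatrix,
      xPart_smul, xPart_linLam, lamB_sub, xPart_sub, Matrix.mulVec_sub]
    module
  have gs : ∀ i, sigPart g i = (τ.t2 i)⁻¹ • (sigPart ψh i - sigPart ψb i) -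
      (1 / 2 : ℝ) • lamB ψh i := fun i => by
    rw [hg, skewB, Matrix.smul_mulVec, sigPart_sub, sigPart_designMatrix,
      sigPart_smul, sigPart_linLam, lamB_sub, sigPart_sub]
    module
  have gl : ∀ e, lamPart g e = 0 := fun e => by
    rw [hg, skewB, Matrix.smul_mulVec, lamPart_sub, lamPart_designMatrix,
      lamPart_smul, lamPart_linLam, lamPart_sub, disagreement_sub]
    have h3 : lamPart ψh e - lamPart ψb e =
        -(τ.t3 e • (disagreement ψb e - (1 / 2 : ℝ) • disagreement ψh e)) := by
      rw [h.lamBar e]; abel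
    rw [h3, smul_neg, smul_smul, inv_mul_cancel₀ (τ.t3_pos e).ne']
    module
  have gy : ∀ i, yPart g i = (τ.t4 i)⁻¹ • (yPart ψh i - yPart ψb i) := fun i => by
    rw [hg, skewB, Matrix.smul_mulVec, yPart_sub, yPart_designMatrix,
      yPart_smul, yPart_linLam, yPart_sub]
    simp
  have gm : ∀ e, muPart g e = 0 := fun e => by
    rw [hg, skewB, Matrix.smul_mulVec, muPart_sub, muPart_designMatrix,
      muPart_smul, muPart_linLam, muPart_sub, h.muBar]
    simp
  have gye : ∀ e, yEdgePart g e = (τ.t4 e.1.1)⁻¹ • (yEdgePart ψh e - yEdgePart ψb e) :=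
    fun e => by
    rw [hg, skewB, Matrix.smul_mulVec, yEdgePart_sub, yEdgePart_designMatrix,
      yEdgePart_smul, yEdgePart_linLam, yEdgePart_sub]
    simp
  rw [dotProduct_eq_parts]
  simp only [gl, gm, zero_dotProduct, Finset.sum_const_zero, add_zero]
  -- Grouping the edge terms by head splits the inequality into one variational inequality per
  -- agent.
  rw [← sum_inEdge, ← Finset.sum_add_distrib, ← Finset.sum_add_distrib, ← Finset.sum_add_distrib]
  refine Finset.sum_nonpos fun i _ => ?_
  have h1 := argminB_variational hX (h.feasB i) (h.argminB i) (hw i)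
  have h2 : gradB τ ψh i (localPart ψb i) (localPart w i - localPart ψb i) =
      -(xPart g i ⬝ᵥ xPart (w - ψb) i + sigPart g i ⬝ᵥ sigPart (w - ψb) i +
        yPart g i ⬝ᵥ yPart (w - ψb) i +
        ∑ e : P.InEdge i, yEdgePart g e.1 ⬝ᵥ yEdgePart (w - ψb) e.1) := by
    have e1 : ∀ z, P.projX i (localPart z i) = xPart z i := fun _ => rfl
    have e2 : ∀ z, P.projSig i (localPart z i) = sigPart z i := fun _ => rfl
    have e3 : ∀ z, P.projY i (localPart z i) = yPart z i := fun _ => rfl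
    have e4 : ∀ e z, P.projYEdge i e (localPart z i) = yEdgePart z e.1 := fun _ _ => rfl
    have hsub : localPart w i - localPart ψb i = localPart (w - ψb) i := rfl
    have hc : ∀ t : ℝ, 2 * (1 / (2 * t)) = t⁻¹ := fun t => by
      rw [mul_one_div, mul_comm 2 t, div_mul_cancel_right₀ two_ne_zero]
    simp only [gradB, LinearMap.add_apply, LinearMap.smul_apply, LinearMap.comp_apply,
      dotProductBilin_apply_apply, LinearMap.sum_apply, hsub, e1, e2, e3, e4, gx, gs, gy, gye,
      xPart_sub, sigPart_sub, yPart_sub, yEdgePart_sub, hc, smul_eq_mul]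
    rw [neg_add, ← Finset.sum_neg_distrib]
    congr 1
    · simp only [sub_dotProduct, smul_dotProduct, smul_eq_mul]
      have := (τ.t1_pos i).ne'
      have := (τ.t2_pos i).ne'
      have := (τ.t4_pos i).ne'
      field_simp
      ring
    · refine Finset.sum_congr rfl fun e _ => ?_
      simp only [sub_dotProduct, smul_dotProduct, smul_eq_mul]
      ring
  rw [h2] at h1
  linarith

end Network

/-! ### Extended-real sums, indicators and convex domains -/

theorem EReal.lt_top_of_sum_lt_top {κ : Type*} [Fintype κ] {f : κ → EReal}
    (hbot : ∀ k, f k ≠ ⊥) (h : ∑ k, f k < ⊤) (k : κ) : f k < ⊤ := by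
  classical
  have hne : ∀ s : Finset κ, ∑ j ∈ s, f j ≠ ⊥ := by
    intro s
    induction s using Finset.induction_on with
    | empty => simp
    | insert j s hj ih =>
      rw [Finset.sum_insert hj]
      exact EReal.add_ne_bot_iff.2 ⟨hbot j, ih⟩
  by_contra hcon
  rw [← Finset.add_sum_erase _ _ (Finset.mem_univ k), not_lt_top_iff.1 hcon,
    EReal.top_add_of_ne_bot (hne _)] at h
  exact lt_irrefl _ h

theorem iota_of_mem {α : Type*} {S : Set α} {z : α} (h : z ∈ S) : iota S z = 0 := if_pos h

theorem iota_ne_bot {α : Type*} (S : Set α) (z : α) : iota S z ≠ ⊥ := by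
  unfold iota
  split_ifs <;> simp

theorem mem_of_iota_lt_top {α : Type*} {S : Set α} {z : α} (h : iota S z < ⊤) : z ∈ S := by
  by_contra hz
  rw [iota, if_neg hz] at h
  exact lt_irrefl _ h

theorem EReal.lt_top_of_add_lt_top {a b : EReal} (ha : a ≠ ⊥) (hb : b ≠ ⊥) (h : a + b < ⊤) :
    a < ⊤ ∧ b < ⊤ := by
  constructor <;> by_contra hcon <;> rw [not_lt_top_iff.1 hcon] at h
  · rw [EReal.top_add_of_ne_bot hb] at h
    exact lt_irrefl _ h
  · rw [EReal.add_top_of_ne_bot ha] at h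
    exact lt_irrefl _ h

theorem EReal.coe_finset_sum {κ : Type*} (s : Finset κ) (f : κ → ℝ) :
    ((∑ k ∈ s, f k : ℝ) : EReal) = ∑ k ∈ s, (f k : EReal) := by
  classical
  induction s using Finset.induction_on with
  | empty => simp
  | insert j s hj ih => rw [Finset.sum_insert hj, Finset.sum_insert hj, EReal.coe_add, ih]

theorem Prolongable.eventually_mem {E : Type*} [AddCommGroup E] [Module ℝ E] {S : Set E}
    (hS : Convex ℝ S) {z : E} (hz : Prolongable S z) {w : E} (hw : w ∈ S) :
    ∀ᶠ ε in 𝓝[>] (0 : ℝ), z - ε • (w - z) ∈ S := by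
  obtain ⟨ε, hε, h⟩ := hz.prolong w hw
  filter_upwards [Ioc_mem_nhdsGT hε] with δ hδ
  exact hS.sub_smul_mem_of_le hz.mem h hδ.1.le hδ.2

theorem IsCCP.convex_effDom {E : Type*} [NormedAddCommGroup E] [NormedSpace ℝ E] {f : E → EReal}
    (hf : IsCCP f) : Convex ℝ (effDom f) := by
  rw [← hf.fst_image_epi]
  exact hf.convex_epi.linear_image (LinearMap.fst ℝ E ℝ)

namespace Network

variable {N l : ℕ} {n : Fin N → ℕ} {P : Network N l n}

/-! ### Consensus and the weight matrix -/

theorem Communicable.eq_of_edge_eq (hG : P.Communicable) {α : Type*} {f : Fin N → α}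
    (hf : ∀ i j, (i, j) ∈ P.E → f i = f j) (i j : Fin N) : f i = f j := by
  have key : ∀ {i j : Fin N}, (SimpleGraph.fromRel fun i j => (i, j) ∈ P.E).Walk i j →
      f i = f j := by
    intro i j p
    induction p with
    | nil => rfl
    | cons h _ ih =>
      rw [← ih]
      rw [SimpleGraph.fromRel_adj] at h
      rcases h.2 with h | h
      · exact hf _ _ h
      · exact (hf _ _ h).symm
  obtain ⟨p⟩ := hG.connected.preconnected i j
  exact key p

theorem IsWeighted.sum_row (hW : P.IsWeighted) (i : Fin N) : ∑ j, P.W i j = 0 := by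
  rw [← Finset.add_sum_erase _ _ (Finset.mem_univ i), hW.diag i]
  ring

/-- Maximum principle: at a maximizer of u all terms W_ik (u_k - max u) are nonnegative and sum to
zero, so every out-neighbour is a maximizer too; connectedness spreads this to all agents. -/
theorem IsWeighted.eq_of_mulVec_eq_zero (hW : P.IsWeighted) (hG : P.Communicable)
    {u : Fin N → ℝ} (hu : P.W *ᵥ u = 0) (i j : Fin N) : u i = u j := by
  have : Nonempty (Fin N) := ⟨i⟩
  obtain ⟨m, hm⟩ := Finite.exists_max u
  have hnonpos : ∀ i j, i ≠ j → P.W i j ≤ 0 := fun i j hij => by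
    by_cases h : (i, j) ∈ P.E
    · exact (hW.neg i j h).le
    · exact (hW.zero i j hij h).le
  have hstep : ∀ i j, (i, j) ∈ P.E → u i = u m → u j = u m := by
    intro i j hij hi
    have h1 : ∑ k, P.W i k * (u k - u m) = 0 := by
      have h2 := congrFun hu i
      simp only [Matrix.mulVec, dotProduct, Pi.zero_apply] at h2
      simp only [mul_sub, Finset.sum_sub_distrib, ← Finset.sum_mul, h2, hW.sum_row]
      ring
    have h3 : ∀ k ∈ Finset.univ, 0 ≤ P.W i k * (u k - u m) := fun k _ => by
      by_cases hik : i = k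
      · rw [← hik, hi, sub_self, mul_zero]
      · exact mul_nonneg_of_nonpos_of_nonpos (hnonpos i k hik) (by linarith [hm k])
    have h4 := (Finset.sum_eq_zero_iff_of_nonneg h3).1 h1 j (Finset.mem_univ j)
    rcases mul_eq_zero.1 h4 with h | h
    · exact absurd h (hW.neg i j hij).ne
    · linarith
  -- Being a maximizer is treated as a `Prop`-valued function that is constant along edges.
  have hprop : ∀ i, (u i = u m) = (u m = u m) := fun i =>
    hG.eq_of_edge_eq (f := fun i => u i = u m)
      (fun i j hij => propext ⟨hstep i j hij, hstep j i (hG.symm i j hij)⟩) i m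
  have hall : ∀ i, u i = u m := fun i => (hprop i).mpr rfl
  rw [hall i, hall j]

theorem sum_inEdge_tail {M : Type*} [AddCommMonoid M] (i : Fin N) (f : Fin N → M) :
    ∑ e : P.InEdge i, f e.1.1.1 = ∑ j, if (j, i) ∈ P.E then f j else 0 := by
  rw [← Finset.sum_filter]
  refine Finset.sum_bij (fun e _ => e.1.1.1) (fun e _ => ?_) (fun e _ e' _ h => ?_)
    (fun j hj => ?_) (fun _ _ => rfl)
  · have h2 : e.1.1 = (e.1.1.1, i) := Prod.ext rfl e.2
    simpa using h2 ▸ e.1.2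
  · exact Subtype.ext (Subtype.ext (Prod.ext h (e.2.trans e'.2.symm)))
  · exact ⟨⟨⟨(j, i), by simpa using hj⟩, rfl⟩, Finset.mem_univ _, rfl⟩

theorem IsWeighted.sum_inEdge_smul (hW : P.IsWeighted) (hG : P.Communicable) (i : Fin N)
    (y : Fin N → Fin l → ℝ) :
    P.W i i • y i + ∑ e : P.InEdge i, P.W e.1.1.1 i • y e.1.1.1 = ∑ j, P.W j i • y j := by
  rw [sum_inEdge_tail i fun j => P.W j i • y j, ← Finset.add_sum_erase _ _ (Finset.mem_univ i),
    if_neg (hG.no_loops i), zero_add, ← Finset.add_sum_erase _ (fun j => P.W j i • y j)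
    (Finset.mem_univ i)]
  congr 1
  refine Finset.sum_congr rfl fun j hj => ?_
  split_ifs with h
  · rfl
  · rw [hW.zero j i (Finset.ne_of_mem_erase hj) h, zero_smul]

/-- The range of Wᵀ is the orthogonal complement of ker W, and ker W contains only constants. This
supplies the y that makes the F_i hold. -/
theorem IsWeighted.exists_potential (hW : P.IsWeighted) (hG : P.Communicable)
    {v : Fin N → Fin l → ℝ} (hv : ∑ i, v i = 0) :
    ∃ y : Fin N → Fin l → ℝ, ∀ i, v i = ∑ j, P.W j i • y j := by
  have h : ∀ a, ∃ y : Fin N → ℝ, P.Wᵀ *ᵥ y = fun i => v i a := fun a => by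
    refine Matrix.exists_transpose_mulVec_eq fun u hu => ?_
    obtain ⟨m⟩ := hG.connected.nonempty
    have h1 : u = fun _ => u m := funext fun i => hW.eq_of_mulVec_eq_zero hG hu i m
    have h2 := congrFun hv a
    rw [Finset.sum_apply] at h2
    rw [h1, dotProduct, ← Finset.sum_mul, h2, Pi.zero_apply, zero_mul]
  choose y hy using h
  refine ⟨fun j a => y a j, fun i => ?_⟩
  ext a
  have := congrFun (hy a) i
  simp only [Matrix.mulVec, dotProduct, Matrix.transpose_apply] at this
  simp [← this, Finset.sum_apply]

variable (P) in
/-- The constraints `Q_i` and `F_i` of all agents. -/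
def coupledStates : Set P.State :=
  {ψ | ∀ i, localPart ψ i ∈ P.setF i ∧ P.A i *ᵥ xPart ψ i + sigPart ψ i ≤ P.c}

theorem mem_localStates_iff {ψ : P.State} :
    ψ ∈ P.localStates ↔ (∀ i, xPart ψ i ∈ P.X i) ∧ ψ ∈ P.coupledStates :=
  ⟨fun h => ⟨fun i => (h i).1, fun i => (h i).2⟩, fun h i => ⟨h.1 i, h.2 i⟩⟩

theorem add_aggregate (x : (i : Fin N) → Fin (n i) → ℝ) (i : Fin N) :
    P.A i *ᵥ x i + P.aggregate x i = ∑ j, P.A j *ᵥ x j :=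
  Finset.add_sum_erase _ (fun j => P.A j *ᵥ x j) (Finset.mem_univ i)

/-- Every point that satisfies the coupling constraint extends to a state in consensus. -/
theorem exists_consensus_state (hG : P.Communicable) (hW : P.IsWeighted)
    {x : (i : Fin N) → Fin (n i) → ℝ} (hx : ∑ i, P.A i *ᵥ x i ≤ P.c) :
    ∃ ψ : P.State, xPart ψ = x ∧ sigPart ψ = P.aggregate x ∧ (∀ e, lamPart ψ e = 0) ∧
      (∀ e, muPart ψ e = 0) ∧ ψ ∈ P.coupledStates ∧ P.linT *ᵥ ψ = 0 := by
  obtain ⟨y, hy⟩ := hW.exists_potential hG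
    (v := fun i => ((N : ℝ) - 1) • (P.A i *ᵥ x i) - P.aggregate x i) (by
      have h1 : ∀ i, P.aggregate x i = ∑ j, P.A j *ᵥ x j - P.A i *ᵥ x i := fun i => by
        rw [← add_aggregate x i]; abel
      simp only [h1, Finset.sum_sub_distrib, ← Finset.smul_sum, Finset.sum_const, Finset.card_univ,
        Fintype.card_fin, ← Nat.cast_smul_eq_nsmul ℝ]
      module)
  refine ⟨mkState x (P.aggregate x) 0 y 0 (fun e => y e.1.1), rfl, rfl, fun _ => rfl,
    fun _ => rfl, fun i => ⟨?_, ?_⟩, ?_⟩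
  · change _ = _
    simp only [localPart, xPart_mkState, sigPart_mkState, yPart_mkState, yEdgePart_mkState]
    rw [hy i, hW.sum_inEdge_smul hG i y]
  · simp only [xPart_mkState, sigPart_mkState, add_aggregate]
    exact hx
  · set ψ : P.State := mkState x (P.aggregate x) 0 y 0 (fun e => y e.1.1) with hψ
    have hl : ∀ i, lamB ψ i = 0 := fun i => by simp [lamB, hψ]
    have hm : ∀ e, muPart ψ e = 0 := fun _ => rfl
    rw [linT_eq, Matrix.add_mulVec]
    refine state_ext (fun i => ?_) (fun i => ?_) (fun e => ?_) (fun i => ?_) (fun e => ?_)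
      (fun e => ?_)
    · rw [xPart_add, xPart_linLam, xPart_linOmega, hl, Matrix.mulVec_zero, add_zero]; rfl
    · rw [sigPart_add, sigPart_linLam, sigPart_linOmega, hl, add_zero]; rfl
    · rw [lamPart_add, lamPart_linLam, lamPart_linOmega, add_zero]
      simp only [disagreement, hψ, xPart_mkState, sigPart_mkState, add_aggregate, sub_sub,
        sub_self, neg_zero]
      rfl
    · rw [yPart_add, yPart_linLam, yPart_linOmega, zero_add]
      simp only [hm, ite_self, Finset.sum_const_zero, neg_zero]
      rfl
    · rw [muPart_add, muPart_linLam, muPart_linOmega, zero_add]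
      simp only [hψ, yPart_mkState, yEdgePart_mkState, sub_self]
      rfl
    · rw [yEdgePart_add, yEdgePart_linLam, yEdgePart_linOmega, hm, zero_add]
      rfl

theorem disagreement_eq_zero_of_lamPart {ψ : P.State} {e : P.Edge}
    (h : lamPart (P.linT *ᵥ ψ) e = 0) : disagreement ψ e = 0 := by
  rwa [linT_eq, Matrix.add_mulVec, lamPart_add, lamPart_linLam, lamPart_linOmega, add_zero,
    neg_eq_zero] at h

theorem yPart_eq_of_muPart {ψ : P.State} {e : P.Edge}
    (h : muPart (P.linT *ᵥ ψ) e = 0) : yPart ψ e.1.1 = yEdgePart ψ e := by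
  rwa [linT_eq, Matrix.add_mulVec, muPart_add, muPart_linLam, muPart_linOmega, zero_add,
    sub_eq_zero] at h

/-- States in consensus carry the exact aggregates and satisfy the coupling constraint. -/
theorem aggregate_of_consensus (hG : P.Communicable) (hW : P.IsWeighted) {ψ : P.State}
    (hψ : ψ ∈ P.coupledStates) (hl : ∀ e, lamPart (P.linT *ᵥ ψ) e = 0)
    (hm : ∀ e, muPart (P.linT *ᵥ ψ) e = 0) :
    sigPart ψ = P.aggregate (xPart ψ) ∧ ∑ i, P.A i *ᵥ xPart ψ i ≤ P.c := by
  have hcons : ∀ i j, P.A i *ᵥ xPart ψ i + sigPart ψ i = P.A j *ᵥ xPart ψ j + sigPart ψ j :=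
    hG.eq_of_edge_eq (f := fun i => P.A i *ᵥ xPart ψ i + sigPart ψ i) fun i j hij => by
      have := disagreement_eq_zero_of_lamPart (hl ⟨(i, j), hij⟩)
      rw [disagreement, sub_sub, sub_eq_zero] at this
      exact this.symm
  have hF : ∀ i, ((N : ℝ) - 1) • (P.A i *ᵥ xPart ψ i) - sigPart ψ i =
      ∑ j, P.W j i • yPart ψ j := fun i => by
    have h1 : ((N : ℝ) - 1) • (P.A i *ᵥ xPart ψ i) - sigPart ψ i =
      P.W i i • yPart ψ i + ∑ e : P.InEdge i, P.W e.1.1.1 i • yEdgePart ψ e.1 := (hψ i).1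
    rw [h1, ← hW.sum_inEdge_smul hG]
    simp only [yPart_eq_of_muPart (hm _)]
  -- Summing the F_i over all agents removes y, because the rows of W sum to zero; no symmetry of W
  -- is needed.
  have hsum : ∑ i, (((N : ℝ) - 1) • (P.A i *ᵥ xPart ψ i) - sigPart ψ i) = 0 := by
    simp only [hF]
    rw [Finset.sum_comm]
    simp only [← Finset.sum_smul, hW.sum_row, zero_smul, Finset.sum_const_zero]
  have hN : (N : ℝ) ≠ 0 := by
    obtain ⟨m⟩ := hG.connected.nonempty
    exact_mod_cast (Fin.pos m).ne'
  have hz : ∀ i, P.A i *ᵥ xPart ψ i + sigPart ψ i = ∑ j, P.A j *ᵥ xPart ψ j := fun i => by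
    have h1 : ∑ j, (P.A j *ᵥ xPart ψ j + sigPart ψ j) =
        (N : ℝ) • (P.A i *ᵥ xPart ψ i + sigPart ψ i) := by
      rw [Finset.sum_congr rfl fun j _ => hcons j i, Finset.sum_const, Finset.card_univ,
        Fintype.card_fin, Nat.cast_smul_eq_nsmul ℝ]
    rw [Finset.sum_add_distrib] at h1
    rw [Finset.sum_sub_distrib, ← Finset.smul_sum, sub_eq_zero] at hsum
    rw [← hsum] at h1
    have h2 : (N : ℝ) • (P.A i *ᵥ xPart ψ i + sigPart ψ i) =
        (N : ℝ) • ∑ j, P.A j *ᵥ xPart ψ j := by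
      rw [← h1]
      module
    exact smul_right_injective _ hN h2
  obtain ⟨m⟩ := hG.connected.nonempty
  refine ⟨funext fun i => ?_, (hz m) ▸ (hψ m).2⟩
  have := (hz i).trans (add_aggregate (xPart ψ) i).symm
  exact add_left_cancel this

/-! ### Values of the objectives -/

theorem totalCost_eq {x : (i : Fin N) → Fin (n i) → ℝ} {b : Fin N → ℝ}
    (hb : ∀ i, P.J i (x i, P.aggregate x i) = b i) : P.totalCost x = ((∑ i, b i : ℝ) : EReal) := by
  rw [totalCost, EReal.coe_finset_sum]
  exact Finset.sum_congr rfl fun i _ => hb i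

theorem exists_values (hJ : ∀ i, IsCCP (P.J i)) {x : (i : Fin N) → Fin (n i) → ℝ}
    (hx : P.totalCost x < ⊤) : ∃ b : Fin N → ℝ, ∀ i, P.J i (x i, P.aggregate x i) = b i := by
  choose b hb using fun i => (hJ i).exists_eq_coe
    (EReal.lt_top_of_sum_lt_top (fun i => (hJ i).ne_bot _) hx i)
  exact ⟨b, hb⟩

/-- Any feasible competitor of finite cost lifts to a consensus state w in ker `linT`. Skew-symmetry
makes `linT *ᵥ ψ` orthogonal to w - ψ, so the two subgradient inequalities add up to the comparison
of costs. -/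
theorem mem_minimizers (hJ : ∀ i, IsCCP (P.J i)) (hG : P.Communicable) (hW : P.IsWeighted)
    {ψ g₁ g₂ : P.State} (h₁ : P.relJ ψ g₁) (h₂ : P.relS ψ g₂) (h : g₁ + g₂ + P.linT *ᵥ ψ = 0)
    (hl : ∀ e, lamPart (P.linT *ᵥ ψ) e = 0) (hm : ∀ e, muPart (P.linT *ᵥ ψ) e = 0) :
    xPart ψ ∈ P.minimizers := by
  obtain ⟨b, hb, hg⟩ := h₁
  obtain ⟨hS, hg₂⟩ := h₂
  rw [mem_localStates_iff] at hS
  obtain ⟨hsig, hfeas⟩ := aggregate_of_consensus hG hW hS.2 hl hm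
  rw [hsig] at hb
  have hcost := totalCost_eq hb
  refine ⟨⟨hS.1, hfeas⟩, by rw [hcost]; exact EReal.coe_lt_top _, fun x hx => ?_⟩
  by_cases htop : P.totalCost x = ⊤
  · rw [htop]; exact le_top
  obtain ⟨a, ha⟩ := exists_values hJ (lt_top_iff_ne_top.2 htop)
  obtain ⟨w, hwx, hws, -, -, hwc, hwT⟩ := exists_consensus_state hG hW hx.2
  rw [hcost, totalCost_eq ha, EReal.coe_le_coe_iff]
  have k1 := hg w a fun i => by rw [hwx, hws]; exact (ha i).le
  have k2 := hg₂ w (mem_localStates_iff.2 ⟨fun i => by rw [hwx]; exact hx.1 i, hwc⟩)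
  have k3 : (P.linT *ᵥ ψ) ⬝ᵥ (w - ψ) = 0 := by
    have h3 := mulVec_dotProduct_of_skew linT_transpose ψ ψ
    rw [dotProduct_comm ψ] at h3
    rw [dotProduct_sub, mulVec_dotProduct_of_skew linT_transpose ψ w, hwT, dotProduct_zero]
    linarith
  have k4 : g₁ ⬝ᵥ (w - ψ) + g₂ ⬝ᵥ (w - ψ) + (P.linT *ᵥ ψ) ⬝ᵥ (w - ψ) = 0 := by
    rw [← add_dotProduct, ← add_dotProduct, h, zero_dotProduct]
  linarith

/-- The easy inclusion of the subdifferential sum rule, by adding inequalities; the work lies in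
extracting real values where the extended-real sum is finite. -/
theorem add_mem_subdiff_convexPart (hJ : ∀ i, IsCCP (P.J i)) {ψ g₁ g₂ : P.State}
    (h₁ : P.relJ ψ g₁) (h₂ : P.relS ψ g₂) : g₁ + g₂ ∈ subdiff P.convexPart ψ := by
  obtain ⟨b, hb, hg⟩ := h₁
  obtain ⟨hS, hg₂⟩ := h₂
  have hval : ∀ w ∈ P.localStates, ∀ a : Fin N → ℝ, (∀ i, P.J i (xPart w i, sigPart w i) = a i) →
      P.convexPart w = ((∑ i, a i : ℝ) : EReal) := fun w hw a ha => by
    rw [convexPart, EReal.coe_finset_sum]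
    refine Finset.sum_congr rfl fun i _ => ?_
    rw [ha i, iota_of_mem (show xPart w i ∈ P.X i from (hw i).1), iota_of_mem (hw i).2.1,
      iota_of_mem (show (xPart w i, sigPart w i) ∈ P.setQ i from (hw i).2.2)]
    simp
  intro w
  by_cases htop : P.convexPart w = ⊤
  · rw [htop]; exact le_top
  have hbot : ∀ i, P.J i (xPart w i, sigPart w i) + iota (P.X i) (xPart w i) ≠ ⊥ := fun i =>
    EReal.add_ne_bot_iff.2 ⟨(hJ i).ne_bot _, iota_ne_bot _ _⟩
  have hbot' : ∀ i, P.J i (xPart w i, sigPart w i) + iota (P.X i) (xPart w i) +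
      iota (P.setQ i) (xPart w i, sigPart w i) ≠ ⊥ := fun i =>
    EReal.add_ne_bot_iff.2 ⟨hbot i, iota_ne_bot _ _⟩
  have hlt := EReal.lt_top_of_sum_lt_top
    (fun i => EReal.add_ne_bot_iff.2 ⟨hbot' i, iota_ne_bot (P.setF i) (localPart w i)⟩)
    (lt_top_iff_ne_top.2 htop)
  have hparts := fun i => EReal.lt_top_of_add_lt_top (hbot' i) (iota_ne_bot _ _) (hlt i)
  have hparts' := fun i => EReal.lt_top_of_add_lt_top (hbot i) (iota_ne_bot _ _) (hparts i).1
  have hparts'' := fun i =>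
    EReal.lt_top_of_add_lt_top ((hJ i).ne_bot _) (iota_ne_bot _ _) (hparts' i).1
  choose a ha using fun i => (hJ i).exists_eq_coe (hparts'' i).1
  have hw : w ∈ P.localStates := fun i => ⟨mem_of_iota_lt_top (hparts'' i).2,
    mem_of_iota_lt_top (hparts i).2, mem_of_iota_lt_top (hparts' i).2⟩
  rw [hval ψ hS b hb, hval w hw a ha, ← EReal.coe_add, EReal.coe_le_coe_iff, add_dotProduct]
  linarith [hg w a fun i => (ha i).le, hg₂ w hw]

end Network

theorem LinearMap.exists_dotProduct_eq {ι : Type*} [Fintype ι] [DecidableEq ι]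
    (φ : (ι → ℝ) →ₗ[ℝ] ℝ) : ∃ g : ι → ℝ, ∀ u, φ u = g ⬝ᵥ u := by
  refine ⟨fun a => φ fun j => if a = j then 1 else 0, fun u => ?_⟩
  rw [φ.pi_apply_eq_sum_univ u, dotProduct_comm]
  rfl

namespace Network

variable {N l : ℕ} {n : Fin N → ℕ} {P : Network N l n}

/-! ### Existence of multipliers -/

/-- The state with multipliers `λ`, `μ` taken from `ψ` and all other components zero. -/
def dualState (ψ : P.State) : P.State := mkState 0 0 (lamPart ψ) 0 (muPart ψ) 0

theorem dotProduct_dualState (g ψ : P.State) : g ⬝ᵥ dualState ψ =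
    ∑ e, lamPart g e ⬝ᵥ lamPart ψ e + ∑ e, muPart g e ⬝ᵥ muPart ψ e := by
  rw [dotProduct_eq_parts]
  simp [dualState]

theorem dual_parts_eq_zero {g : P.State} (h : g ⬝ᵥ dualState g ≤ 0) :
    (∀ e, lamPart g e = 0) ∧ ∀ e, muPart g e = 0 := by
  rw [dotProduct_dualState] at h
  have h1 : ∀ e ∈ Finset.univ, 0 ≤ lamPart g e ⬝ᵥ lamPart g e := fun e _ => sqNorm_nonneg _
  have h2 : ∀ e ∈ Finset.univ, 0 ≤ muPart g e ⬝ᵥ muPart g e := fun e _ => sqNorm_nonneg _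
  have h3 := Finset.sum_nonneg h1
  have h4 := Finset.sum_nonneg h2
  exact ⟨fun e => dotProduct_self_eq_zero.1
      ((Finset.sum_eq_zero_iff_of_nonneg h1).1 (by linarith) e (Finset.mem_univ e)),
    fun e => dotProduct_self_eq_zero.1
      ((Finset.sum_eq_zero_iff_of_nonneg h2).1 (by linarith) e (Finset.mem_univ e))⟩

theorem xPart_add_dualState (ψ ν : P.State) : xPart (ψ + dualState ν) = xPart ψ :=
  funext fun _ => add_zero _

theorem sigPart_add_dualState (ψ ν : P.State) : sigPart (ψ + dualState ν) = sigPart ψ :=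
  funext fun _ => add_zero _

theorem localPart_add_dualState (ψ ν : P.State) (i : Fin N) :
    localPart (ψ + dualState ν) i = localPart ψ i :=
  show localPart ψ i + 0 = _ from add_zero _

/-- The objectives do not see λ and μ, so moving ψ by `dualState g` costs nothing while the
subgradient inequality charges the squared norms of these parts. -/
theorem relJ.dual_parts {ψ g : P.State} (h : P.relJ ψ g) :
    (∀ e, lamPart g e = 0) ∧ ∀ e, muPart g e = 0 := by
  obtain ⟨b, hb, hg⟩ := h
  have := hg (ψ + dualState g) b fun i => by
    rw [xPart_add_dualState, sigPart_add_dualState]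
    exact (hb i).le
  rw [add_sub_cancel_left] at this
  exact dual_parts_eq_zero (by linarith)

theorem relS.dual_parts {ψ g : P.State} (h : P.relS ψ g) :
    (∀ e, lamPart g e = 0) ∧ ∀ e, muPart g e = 0 := by
  obtain ⟨hψ, hg⟩ := h
  have := hg (ψ + dualState g) fun i => by
    rw [localPart_add_dualState]
    exact hψ i
  rw [add_sub_cancel_left] at this
  exact dual_parts_eq_zero this

theorem dotProduct_dualState_eq_zero {g : P.State}
    (hg : (∀ e, lamPart g e = 0) ∧ ∀ e, muPart g e = 0) (ν : P.State) : g ⬝ᵥ dualState ν = 0 := by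
  simp [dotProduct_dualState, hg.1, hg.2]

theorem relJ.add_dualState {ψ g : P.State} (h : P.relJ ψ g) (ν : P.State) :
    P.relJ (ψ + dualState ν) g := by
  have h0 := dotProduct_dualState_eq_zero h.dual_parts ν
  obtain ⟨b, hb, hg⟩ := h
  refine ⟨b, fun i => by rw [xPart_add_dualState, sigPart_add_dualState, hb i], fun w a ha => ?_⟩
  rw [← sub_sub, dotProduct_sub, h0, sub_zero]
  exact hg w a ha

theorem relS.add_dualState {ψ g : P.State} (h : P.relS ψ g) (ν : P.State) :
    P.relS (ψ + dualState ν) g := by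
  have h0 := dotProduct_dualState_eq_zero h.dual_parts ν
  refine ⟨fun i => by rw [localPart_add_dualState]; exact h.1 i, fun w hw => ?_⟩
  rw [← sub_sub, dotProduct_sub, h0, sub_zero]
  exact h.2 w hw

/-- `linT` sends the primal components only to the λ and μ rows, and λ, μ only to the others. When
the former rows vanish, the primal part of ν contributes nothing. -/
theorem linT_dualState {ν : P.State} (hl : ∀ e, lamPart (P.linT *ᵥ ν) e = 0)
    (hm : ∀ e, muPart (P.linT *ᵥ ν) e = 0) : P.linT *ᵥ dualState ν = P.linT *ᵥ ν := by
  refine state_ext (fun i => ?_) (fun i => ?_) (fun e => ?_) (fun i => ?_) (fun e => ?_)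
      (fun e => ?_)
  · rw [linT_eq, Matrix.add_mulVec, Matrix.add_mulVec, xPart_add, xPart_add, xPart_linLam,
      xPart_linLam, xPart_linOmega, xPart_linOmega]
    rfl
  · rw [linT_eq, Matrix.add_mulVec, Matrix.add_mulVec, sigPart_add, sigPart_add, sigPart_linLam,
      sigPart_linLam, sigPart_linOmega, sigPart_linOmega]
    rfl
  · rw [hl, linT_eq, Matrix.add_mulVec, lamPart_add, lamPart_linLam, lamPart_linOmega]
    simp [disagreement, dualState]
  · rw [linT_eq, Matrix.add_mulVec, Matrix.add_mulVec, yPart_add, yPart_add, yPart_linLam,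
      yPart_linLam, yPart_linOmega, yPart_linOmega]
    rfl
  · rw [hm, linT_eq, Matrix.add_mulVec, muPart_add, muPart_linLam, muPart_linOmega]
    simp [dualState]
  · rw [linT_eq, Matrix.add_mulVec, Matrix.add_mulVec, yEdgePart_add, yEdgePart_add,
      yEdgePart_linLam, yEdgePart_linLam, yEdgePart_linOmega, yEdgePart_linOmega]
    rfl

variable (P) in
/-- The local constraints without those sets `X_i` that contain the domain of `J_i` anyway. -/
def relaxedStates : Set P.State :=
  {ψ | (∀ i, effDom (P.J i) ⊆ P.X i ×ˢ Set.univ ∨ xPart ψ i ∈ P.X i) ∧ ψ ∈ P.coupledStates}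

theorem convex_relaxedStates (hX : P.FeasibleSetsRegular) : Convex ℝ P.relaxedStates := by
  rintro z ⟨hz, hz'⟩ w ⟨hw, hw'⟩ s t hs ht hst
  refine ⟨fun i => ?_, fun i => ⟨?_, ?_⟩⟩
  · rcases hz i with h | hzi
    · exact .inl h
    rcases hw i with h | hwi
    · exact .inl h
    exact .inr (hX.convex i hzi hwi hs ht hst)
  · exact smul_add_smul_mem_setF (hz' i).1 (hw' i).1 s t
  · exact convex_setQ i (show (xPart z i, sigPart z i) ∈ P.setQ i from (hz' i).2)
      (show (xPart w i, sigPart w i) ∈ P.setQ i from (hw' i).2) hs ht hst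

/-- A Slater point is relatively interior to the relaxed constraints. -/
theorem IsSlaterPoint.eventually_mem_relaxedStates (hX : P.FeasibleSetsRegular)
    {x : (i : Fin N) → Fin (n i) → ℝ} (hx : P.IsSlaterPoint x) {ψ : P.State} (hψx : xPart ψ = x)
    (hψs : sigPart ψ = P.aggregate x) (hψ : ψ ∈ P.coupledStates) {w : P.State}
    (hw : w ∈ P.relaxedStates) :
    ∀ᶠ ε in 𝓝[>] (0 : ℝ), ψ - ε • (w - ψ) ∈ P.relaxedStates := by
  have h1 : ∀ i, ∀ᶠ ε in 𝓝[>] (0 : ℝ), effDom (P.J i) ⊆ P.X i ×ˢ Set.univ ∨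
      xPart (ψ - ε • (w - ψ)) i ∈ P.X i := fun i => by
    rcases hx.mem_ri_set i with h | h
    · exact .of_forall fun _ => .inl h
    rcases hw.1 i with h' | h'
    · exact .of_forall fun _ => .inl h'
    rw [← hψx] at h
    filter_upwards [(Prolongable.of_mem_intrinsicInterior h).eventually_mem (hX.convex i) h']
      with ε hε using .inr hε
  have h2 : ∀ i a, ∀ᶠ ε in 𝓝[>] (0 : ℝ), (P.A i *ᵥ xPart (ψ - ε • (w - ψ)) i +
      sigPart (ψ - ε • (w - ψ)) i) a < P.c a := fun i a => by
    have hcont : Continuous fun ε : ℝ => (P.A i *ᵥ xPart (ψ - ε • (w - ψ)) i +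
        sigPart (ψ - ε • (w - ψ)) i) a := by
      simp only [xPart_sub, xPart_smul, sigPart_sub, sigPart_smul]
      fun_prop
    refine (hcont.tendsto 0).mono_left nhdsWithin_le_nhds |>.eventually_lt_const ?_
    rw [zero_smul, sub_zero, hψx, hψs, add_aggregate]
    exact hx.strict a
  filter_upwards [eventually_all.2 h1, eventually_all.2 fun i => eventually_all.2 (h2 i)]
    with ε k1 k2
  refine ⟨k1, fun i => ⟨?_, fun a => (k2 i a).le⟩⟩
  -- F_i is a linear subspace, so it allows prolongation without any interiority.
  have := smul_add_smul_mem_setF (hψ i).1 (hw.2 i).1 (1 + ε) (-ε)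
  convert this using 1
  change localPart ψ i - ε • (localPart w i - localPart ψ i) = _
  module

/-- Karush-Kuhn-Tucker conditions: the two relations have a common zero. -/
theorem exists_zero (hJ : ∀ i, IsCCP (P.J i)) (hX : P.FeasibleSetsRegular)
    (hmin : P.minimizers.Nonempty) (hG : P.Communicable) (hW : P.IsWeighted) :
    ∃ ψ g, P.relA ψ g ∧ P.relB ψ (-g) := by
  obtain ⟨xs, hfeas, hfin, hopt⟩ := hmin
  obtain ⟨xb, hxb⟩ := hX.slater
  obtain ⟨b, hb⟩ := exists_values hJ hfin
  obtain ⟨z, hzx, hzs, -, -, hzc, hzT⟩ := exists_consensus_state hG hW hfeas.2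
  obtain ⟨s, hsx, hss, -, -, hsc, hsT⟩ :=
    exists_consensus_state hG hW (x := xb) (fun a => (hxb.strict a).le)
  have hbz : ∀ i, P.J i (xPart z i, sigPart z i) = b i := fun i => by rw [hzx, hzs]; exact hb i
  have hzS : z ∈ P.localStates :=
    mem_localStates_iff.2 ⟨fun i => by rw [hzx]; exact hfeas.1 i, hzc⟩
  have hsub : P.localStates ⊆ P.relaxedStates := fun w hw =>
    ⟨fun i => .inr (hw i).1, (mem_localStates_iff.1 hw).2⟩
  -- Objectives and constraints receive separate copies of the state, tied together only by the
  -- diagonal subspace D below. One separation then yields g₁ and g₂ at once, in place of a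
  -- subdifferential sum rule.
  let C : Set ((P.State × P.State) × ℝ) := {p | ∃ a : Fin N → ℝ,
    (∀ i, P.J i (xPart p.1.1 i, sigPart p.1.1 i) ≤ a i) ∧ ∑ i, a i = p.2 ∧
      p.1.2 ∈ P.relaxedStates}
  have hC : Convex ℝ C := by
    rintro p ⟨a, ha, hap, hp⟩ q ⟨a', ha', haq, hq⟩ r t hr ht hrt
    refine ⟨fun i => r * a i + t * a' i, fun i => ?_, ?_, convex_relaxedStates hX hp hq hr ht hrt⟩
    · exact (hJ i).convex_epi
        (show ((xPart p.1.1 i, sigPart p.1.1 i), a i) ∈ {p | P.J i p.1 ≤ (p.2 : EReal)} from ha i)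
        (show ((xPart q.1.1 i, sigPart q.1.1 i), a' i) ∈ {p | P.J i p.1 ≤ (p.2 : EReal)} from ha' i)
        hr ht hrt
    · rw [Finset.sum_add_distrib, ← Finset.mul_sum, ← Finset.mul_sum, hap, haq]
      rfl
  have hmemC : ∀ w₁ w₂ : P.State, (∀ i, (xPart w₁ i, sigPart w₁ i) ∈ effDom (P.J i)) →
      w₂ ∈ P.relaxedStates → (w₁, w₂) ∈ Prod.fst '' C := fun w₁ w₂ h₁ h₂ => by
    choose a ha using fun i => (hJ i).exists_eq_coe (h₁ i)
    exact ⟨((w₁, w₂), ∑ i, a i), ⟨a, fun i => (ha i).le, rfl, h₂⟩, rfl⟩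
  let D : Submodule ℝ (P.State × P.State) :=
    (LinearMap.ker P.linT.mulVecLin).map (LinearMap.prod LinearMap.id LinearMap.id)
  have hri : ∀ i, (xPart s i, sigPart s i) ∈ intrinsicInterior ℝ (effDom (P.J i)) := fun i => by
    rw [hsx, hss]
    exact hxb.mem_ri_dom i
  obtain ⟨φ, hφD, hφ⟩ := exists_linear_le_of_min C hC D (z := (z, z)) (a := ∑ i, b i)
    ⟨b, fun i => (hbz i).le, rfl, hsub hzS⟩
    (by
      -- On the diagonal both copies agree and lie in ker `linT`, hence carry a feasible point of
      -- (P); sets X_i dropped from `relaxedStates` are recovered from finiteness of J_i.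
      rintro ⟨w₁, w₂⟩ t ⟨a, ha, rfl, hw⟩ ⟨d, hd, hdw⟩
      have e1 : d = w₁ - z := congrArg Prod.fst hdw
      have e2 : d = w₂ - z := congrArg Prod.snd hdw
      have e3 : w₁ = w₂ := sub_left_injective (e1.symm.trans e2)
      subst e3
      have hT : P.linT *ᵥ w₁ = 0 := by
        have : P.linT *ᵥ d = 0 := hd
        rwa [e1, Matrix.mulVec_sub, hzT, sub_zero] at this
      obtain ⟨hsig, hle⟩ := aggregate_of_consensus hG hW hw.2 (fun e => by rw [hT]; rfl)
        (fun e => by rw [hT]; rfl)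
      have hJfin : ∀ i, (xPart w₁ i, sigPart w₁ i) ∈ effDom (P.J i) := fun i =>
        lt_of_le_of_lt (ha i) (EReal.coe_lt_top _)
      choose a' ha' using fun i => (hJ i).exists_eq_coe (hJfin i)
      have hx : xPart w₁ ∈ P.feasible := ⟨fun i => by
        rcases hw.1 i with h | h
        · exact (h (hJfin i)).1
        · exact h, hle⟩
      have h1 := hopt _ hx
      rw [totalCost_eq hb, totalCost_eq (b := a') (fun i => by rw [← hsig]; exact ha' i),
        EReal.coe_le_coe_iff] at h1
      refine h1.trans (Finset.sum_le_sum fun i _ => ?_)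
      have := ha i
      rw [ha' i] at this
      exact_mod_cast this)
    (b := (s, s)) ⟨s - z, by
      change P.linT *ᵥ (s - z) = 0
      rw [Matrix.mulVec_sub, hsT, hzT, sub_zero], rfl⟩
    ⟨hmemC s s (fun i => intrinsicInterior_subset (hri i))
      ⟨fun i => .inr (by rw [hsx]; exact hxb.mem i), hsc⟩, by
      rintro ⟨w₁, w₂⟩ ⟨⟨_, t⟩, ⟨a, ha, -, hw⟩, rfl⟩
      have k1 : ∀ i, ∀ᶠ ε in 𝓝[>] (0 : ℝ), (xPart (s - ε • (w₁ - s)) i,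
          sigPart (s - ε • (w₁ - s)) i) ∈ effDom (P.J i) := fun i =>
        (Prolongable.of_mem_intrinsicInterior (hri i)).eventually_mem (hJ i).convex_effDom
          (w := (xPart w₁ i, sigPart w₁ i)) (lt_of_le_of_lt (ha i) (EReal.coe_lt_top _))
      obtain ⟨ε, ⟨hε1, hε2⟩, hε⟩ := (((eventually_all.2 k1).and
        (hxb.eventually_mem_relaxedStates hX hsx hss hsc hw)).and
        (self_mem_nhdsWithin : Set.Ioi (0 : ℝ) ∈ 𝓝[>] 0)).exists
      exact ⟨ε, hε, hmemC _ _ hε1 hε2⟩⟩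
  obtain ⟨g₁, hg₁⟩ := (φ.comp (LinearMap.inl ℝ P.State P.State)).exists_dotProduct_eq
  obtain ⟨g₂, hg₂⟩ := (φ.comp (LinearMap.inr ℝ P.State P.State)).exists_dotProduct_eq
  have hφg : ∀ u v : P.State, φ (u, v) = g₁ ⬝ᵥ u + g₂ ⬝ᵥ v := fun u v => by
    rw [← hg₁, ← hg₂]
    simp [← map_add]
  have hrJ : P.relJ z g₁ := by
    refine ⟨b, hbz, fun w a ha => ?_⟩
    have := hφ (w, z) (∑ i, a i) ⟨a, ha, rfl, hsub hzS⟩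
    rw [Prod.mk_sub_mk, hφg, sub_self, dotProduct_zero] at this
    linarith
  have hrS : P.relS z g₂ := by
    refine ⟨hzS, fun w hw => ?_⟩
    have := hφ (z, w) (∑ i, b i) ⟨b, fun i => (hbz i).le, rfl, hsub hw⟩
    rw [Prod.mk_sub_mk, hφg, sub_self, dotProduct_zero] at this
    linarith
  -- Vanishing of φ on D says g₁ + g₂ is orthogonal to ker `linT`, so it lies in the range of the
  -- transpose, which is -`linT`. The λ and μ of ν are the multipliers.
  obtain ⟨ν, hν⟩ := Matrix.exists_transpose_mulVec_eq (M := P.linT) (v := g₁ + g₂) fun u hu => by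
    have := hφD (u, u) ⟨u, hu, rfl⟩
    rwa [hφg, ← add_dotProduct] at this
  rw [linT_transpose, Matrix.neg_mulVec] at hν
  have hν' : P.linT *ᵥ ν = -(g₁ + g₂) := by rw [← hν, neg_neg]
  have hT : P.linT *ᵥ (z + dualState ν) = -(g₁ + g₂) := by
    rw [Matrix.mulVec_add, hzT, zero_add, linT_dualState, hν']
    · intro e
      rw [hν', ← neg_one_smul ℝ, lamPart_smul, lamPart_add, hrJ.dual_parts.1, hrS.dual_parts.1]
      simp
    · intro e
      rw [hν', ← neg_one_smul ℝ, muPart_smul, muPart_add, hrJ.dual_parts.2, hrS.dual_parts.2]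
      simp
  refine ⟨z + dualState ν, g₁ + P.skewA *ᵥ (z + dualState ν), ?_, ?_⟩
  · change P.relJ _ _
    rw [add_sub_cancel_right]
    exact hrJ.add_dualState ν
  · change P.relS _ _
    have : -(g₁ + P.skewA *ᵥ (z + dualState ν)) - P.skewB *ᵥ (z + dualState ν) = g₂ := by
      rw [neg_add, sub_eq_add_neg, add_assoc, ← neg_add, ← Matrix.add_mulVec, skewA_add_skewB, hT]
      abel
    rw [this]
    exact hrS.add_dualState ν

/-- One iteration is a first step, a reflection, a second step and a relaxation. -/
theorem iteration_iff {τ : P.StepSizes} {γ : ℝ} {ψt ψ ψh ψb ψt' : P.State} :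
    Iteration τ γ ψt ψ ψh ψb ψt' ↔ FirstStep τ ψt ψ ∧ ψh = (2 : ℝ) • ψ - ψt ∧
      SecondStep τ ψh ψb ∧ ψt' = ψt + (2 * γ) • (ψb - ψ) := by
  constructor
  · rintro ⟨h1, h2, rfl, h4, h5, h6, h7, h8, h9⟩
    exact ⟨⟨h1, h2, h4⟩, rfl, ⟨h5, h6, h7, h8⟩, h9⟩
  · rintro ⟨⟨h1, h2, h4⟩, rfl, ⟨h5, h6, h7, h8⟩, h9⟩
    exact ⟨h1, h2, rfl, h4, h5, h6, h7, h8, h9⟩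

end Network

end

theorem theorem2 {N l : ℕ} {n : Fin N → ℕ} (P : Network N l n)
    (hJ : ∀ i, IsCCP (P.J i))
    (hX : P.FeasibleSetsRegular)
    (hmin : P.minimizers.Nonempty)
    (hG : P.Communicable)
    (hW : P.IsWeighted)
    (τ : P.StepSizes)
    (hΦ : (Network.designMatrix τ).PosDef)
    (γ : ℕ → ℝ)
    (hγ : ∀ k, γ k ∈ Set.Icc (0 : ℝ) 1)
    (hγsum : Tendsto (fun m => ∑ k ∈ Finset.range m, γ k * (1 - γ k)) atTop atTop)
    (ψ0 : P.State) :
    (∃ ψ : ℕ → P.State, Network.IsGenerated τ γ ψ0 ψ) ∧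
    ∀ ψ : ℕ → P.State, Network.IsGenerated τ γ ψ0 ψ →
      ∃ ψs ∈ zer P.opT,
        Tendsto ψ atTop (𝓝 ψs) ∧
        Tendsto (fun k => Network.xPart (ψ k)) atTop (𝓝 (Network.xPart ψs)) ∧
        Network.xPart ψs ∈ P.minimizers := by
  have hne : ∀ i, (P.localFeasB i).Nonempty := fun i => by
    obtain ⟨x, hx, -⟩ := hmin
    obtain ⟨w, hwx, -, -, -, hwc, -⟩ := Network.exists_consensus_state hG hW hx.2
    exact ⟨Network.localPart w i, by
      have : w ∈ P.localStates :=
        Network.mem_localStates_iff.2 ⟨fun i => by rw [hwx]; exact hx.1 i, hwc⟩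
      exact this i⟩
  have hA := Network.exists_firstStep hJ hX τ
  have hB := Network.exists_secondStep hX hne τ
  refine ⟨?_, ?_⟩
  · choose fA hfA using hA
    choose fB hfB using hB
    let ψt : ℕ → P.State := Nat.rec ψ0 fun k ψt =>
      ψt + (2 * γ k) • (fB ((2 : ℝ) • fA ψt - ψt) - fA ψt)
    -- The shift k - 1 matches iteration k, which produces index k + 1; the entries at index 0 are
    -- unconstrained.
    exact ⟨fun k => fA (ψt (k - 1)), ψt, fun k => (2 : ℝ) • fA (ψt (k - 1)) - ψt (k - 1),
      fun k => fB ((2 : ℝ) • fA (ψt (k - 1)) - ψt (k - 1)), rfl, fun k =>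
      Network.iteration_iff.2 ⟨hfA _, rfl, hfB _, rfl⟩⟩
  · rintro ψ ⟨ψt, ψh, ψb, -, hiter⟩
    have hit := fun k => Network.iteration_iff.1 (hiter k)
    obtain ⟨p, g, hpA, hpB, hlim⟩ := tendsto_relaxed_splitting hΦ Network.isMonotoneRel_relA
      Network.isMonotoneRel_relB (fun z => (hA z).imp fun _ h => h.relA hJ)
      (fun z => (hB z).imp fun _ h => h.relB hX) (Network.exists_zero hJ hX hmin hG hW) hγ hγsum
      (z := ψt) (u := fun k => ψ (k + 1)) (v := fun k => ψb (k + 1))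
      (fun k => (hit k).1.relA hJ)
      (fun k => by
        rw [← (hit k).2.1]
        exact (hit k).2.2.1.relB hX)
      (fun k => (hit k).2.2.2)
    have hlim' : Tendsto ψ atTop (𝓝 p) := (tendsto_add_atTop_iff_nat 1).1 hlim
    have hcont : Continuous (Network.xPart : P.State → _) := by
      unfold Network.xPart
      fun_prop
    have hsum : (g - P.skewA *ᵥ p) + (-g - P.skewB *ᵥ p) + P.linT *ᵥ p = 0 := by
      rw [← Network.skewA_add_skewB, Matrix.add_mulVec]
      abel
    -- Both subgradients have zero λ and μ parts, so these rows of `linT *ᵥ p` vanish, which is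
    -- consensus at the limit.
    have hpT : P.linT *ᵥ p = (-1 : ℝ) • ((g - P.skewA *ᵥ p) + (-g - P.skewB *ᵥ p)) := by
      rw [neg_one_smul]
      exact eq_neg_of_add_eq_zero_right hsum
    have dJ := Network.relJ.dual_parts hpA
    have dS := Network.relS.dual_parts hpB
    refine ⟨p, ⟨_, Network.add_mem_subdiff_convexPart hJ hpA hpB, hsum.symm⟩, hlim',
      (hcont.tendsto p).comp hlim', Network.mem_minimizers hJ hG hW hpA hpB hsum
        (fun e => ?_) (fun e => ?_)⟩
    · rw [hpT, Network.lamPart_smul, Network.lamPart_add, dJ.1, dS.1, add_zero, smul_zero]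
    · rw [hpT, Network.muPart_smul, Network.muPart_add, dJ.2, dS.2, add_zero, smul_zero]
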